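/- Let $n\ge 2$. On the $n\times n$ lattice of qubits let $\mathcal S$ be the stabilizer group of the Bacon–Shor subsystem code, generated by the operators that act as $Z$ on all qubits of two rows or as $X$ on all qubits of two columns, and let $\mathcal G$ be its gauge group, generated by the scalar $iI$, the operators $Z\otimes Z$ on two qubits of the same column and the operators $X\otimes X$ on two qubits of the same row. A hybrid code $[[N,k:m,d:c]]_2$ is a family of $2^m$ mutually orthogonal subspaces (inner codes) $\mathcal C_a$ of dimension $2^k$ in $(\mathbb C^2)^{\otimes N}$, with encodings $\varphi\mapsto\varphi\otimes v_a$ of $A=\mathbb C^{2^k}$ onto $\mathcal C_a$ (so that the outer code, the span of the $\mathcal C_a$, has a subsystem structure $A\otimes B$ with orthonormal basis $(v_a)$ of $B$), such that, with $P_a$ the orthogonal projection onto $\mathcal C_a$: for every Pauli error $E$ of weight less than $d$, all $a,b$ and all $\varphi\in A$, $P_bE(\varphi\otimes v_a)$ is a scalar multiple of $\varphi\otimes v_b$ (the quantum information is protected); and for every Pauli error $F$ of weight less than $c$ and all $a\ne b$, $P_bFP_a=0$ (the classical information is protected). It is a hybrid stabilizer code if the outer code and all inner codes are stabilizer codes.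 (1) From the Bacon–Shor subsystem code $(\mathcal S,\mathcal G)$ one obtains by gauge fixing a hybrid stabilizer code with parameters $$[[n^2,\;1:(n-1)^2,\;n:2]]_2 .$$ That is: there are operators $G^Z_i,G^X_i$, $1\le i\le r=(n-1)^2$, which together with $iI$ and $\mathcal S$ generate $\mathcal G$, such that all of these commute except that $G^Z_i$ and $G^X_i$ anticommute for each $i$; the outer code is the joint $+1$-eigenspace of $\mathcal S$; for a message $a\in\mathbb F_2^{r}$ the inner code $\mathcal C_a$ is the joint $+1$-eigenspace of $\mathcal S$ and the $(-1)^{a_i}G^Z_i$; and $\varphi\otimes v_a=\prod_i(G^X_i)^{a_i}(\varphi\otimes v_0)$. The quantum and classical minimum distances of this code are exactly $n$ and $2$. (2) This code meets the bound $k+m\le N-2(d-1)$ with equality: $1+(n-1)^2=n^2-2(n-1)$. (3) No code built by the following trivial construction has these parameters: use an $((n_1,K,d))_2$ quantum code to encode the quantum information in the first $n_1$ qubits and a (not necessarily linear) $(n_2,M,c)_2$ classical code to encode the classical information in the remaining $n_2$ qubits, giving an $((n_1+n_2,K:M,d:c))_2$ hybrid code. That is, there are no $n_1,n_2$ with $n_1+n_2=n^2$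 for which both an $((n_1,2,n))_2$ quantum code and an $(n_2,2^{(n-1)^2},2)_2$ classical code exist; and no hybrid code built in this way from any quantum code and any classical code, whatever their own distances, has the parameters $[[n^2,1:(n-1)^2,n:2]]_2$. -/

import Mathlib

open scoped BigOperators

noncomputable section

namespace HybridBS

/-! ### Qubits and the error group -/

/-- The Hilbert space `(ℂ²)^{⊗ ι}` of qubits labelled by `ι`; the computational basis is labelled
by the words `ι → 𝔽₂`. -/
abbrev Qubits (ι : Type) [Fintype ι] [DecidableEq ι] : Type :=
  EuclideanSpace ℂ (ι → ZMod 2)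

/-- The group of invertible operators on the qubits. -/
abbrev Op (ι : Type) [Fintype ι] [DecidableEq ι] : Type :=
  Qubits ι ≃ₗ[ℂ] Qubits ι

section Errors

variable {ι : Type} [Fintype ι] [DecidableEq ι]

/-- `X(a) |x⟩ = |x + a⟩`. -/
def opX (a : ι → ZMod 2) : Op ι :=
  (LinearIsometryEquiv.piLpCongrLeft 2 ℂ ℂ (Equiv.addRight a)).toLinearEquiv

/-- The linear map `|x⟩ ↦ (-1)^{b·x} |x⟩`. -/
def signMap (b : ι → ZMod 2) : Qubits ι →ₗ[ℂ] Qubits ι where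
  toFun ψ := WithLp.toLp 2 fun x => (-1 : ℂ) ^ (∑ j, b j * x j).val * ψ x
  map_add' ψ χ := by ext x; simp [mul_add]
  map_smul' r ψ := by ext x; simp [mul_left_comm]

theorem signMap_involutive (b : ι → ZMod 2) : Function.Involutive (signMap b) := by
  intro ψ
  ext x
  simp only [signMap, LinearMap.coe_mk, AddHom.coe_mk]
  rw [← mul_assoc, ← mul_pow]
  simp

/-- `Z(b) |x⟩ = (-1)^{b·x} |x⟩`. -/
def opZ (b : ι → ZMod 2) : Op ι :=
  LinearEquiv.ofInvolutive (signMap b) (signMap_involutive b)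

/-- The scalar operator `i·I`. -/
def opI : Op ι :=
  LinearEquiv.smulOfNeZero ℂ (Qubits ι) Complex.I Complex.I_ne_zero

/-- The scalar operator `-I`. -/
def opNeg : Op ι := LinearEquiv.neg ℂ

/-- The weight of the error `X(a) Z(b)`: the number of tensor components that are not scalar. -/
def weight (a b : ι → ZMod 2) : ℕ :=
  (Finset.univ.filter fun j => a j ≠ 0 ∨ b j ≠ 0).card

variable (ι) in
/-- The error group `{ i^c X(a) Z(b) }` (complex Pauli group). -/
def errorGroup : Subgroup (Op ι) :=
  Subgroup.closure ({opI} ∪ Set.range opX ∪ Set.range opZ)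

/-! ### Stabilizer codes -/

/-- The joint `+1`-eigenspace of a group of operators. -/
def fixedSpace (S : Subgroup (Op ι)) : Submodule ℂ (Qubits ι) where
  carrier := {ψ | ∀ g ∈ S, g ψ = ψ}
  add_mem' h₁ h₂ g hg := by rw [map_add, h₁ g hg, h₂ g hg]
  zero_mem' g _ := map_zero g
  smul_mem' r _ h g hg := by rw [map_smul, h g hg]

/-- A stabilizer group: an abelian subgroup of the error group whose only scalar is the
identity. -/
structure IsStabilizerGroup (S : Subgroup (Op ι)) : Prop where
  le_errorGroup : S ≤ errorGroup ι
  comm : ∀ g ∈ S, ∀ h ∈ S, g * h = h * g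
  scalar_free : ∀ g ∈ S, (∃ r : ℂ, ∀ ψ, g ψ = r • ψ) → g = 1

/-- A stabilizer code: the joint `+1`-eigenspace of some stabilizer group. -/
def IsStabilizerCode (C : Submodule ℂ (Qubits ι)) : Prop :=
  ∃ S : Subgroup (Op ι), IsStabilizerGroup S ∧ C = fixedSpace S

/-! ### Quantum codes and classical codes -/

/-- `C` is an `((|ι|, K, d))₂` quantum code: it has dimension `K` and detects every error of weight
less than `d`, i.e. when an erroneous code state passes the projection onto the code, it is the
original state up to a scalar. -/
structure IsQuantumCode (C : Submodule ℂ (Qubits ι)) (K d : ℕ) : Prop where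
  finrank_eq : Module.finrank ℂ C = K
  detects : ∀ a b : ι → ZMod 2, weight a b < d →
    ∀ ψ ∈ C, ∃ r : ℂ, C.starProjection (opX a (opZ b ψ)) = r • ψ

/-- `D` is a (not necessarily linear) `(|ι|, M, c)₂` classical code. -/
structure IsClassicalCode (D : Finset (ι → ZMod 2)) (M c : ℕ) : Prop where
  card_eq : D.card = M
  le_dist : ∀ x ∈ D, ∀ y ∈ D, x ≠ y → c ≤ hammingDist x y

end Errors

/-! ### Hybrid codes -/

/-- A hybrid code on the qubits `ι`, carrying a quantum state of dimension `K` together with a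
classical message from `μ`. The outer code has the subsystem structure `A ⊗ B` with `A = ℂ^K` and
`B` with orthonormal basis `(v_a)`, and `enc a φ` is the encoded state `φ ⊗ v_a`. -/
structure HybridCode (ι : Type) [Fintype ι] [DecidableEq ι] (K : ℕ) (μ : Type) where
  enc : μ → (EuclideanSpace ℂ (Fin K) →ₗᵢ[ℂ] Qubits ι)
  orthogonal : ∀ a b, a ≠ b → ∀ φ χ, inner ℂ (enc a φ) (enc b χ) = 0

namespace HybridCode

variable {ι : Type} [Fintype ι] [DecidableEq ι] {K : ℕ} {μ : Type}

/-- The inner code for the message `a`. -/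
def innerCode (C : HybridCode ι K μ) (a : μ) : Submodule ℂ (Qubits ι) :=
  LinearMap.range (C.enc a).toLinearMap

/-- The outer code, spanned by all inner codes. -/
def outerCode (C : HybridCode ι K μ) : Submodule ℂ (Qubits ι) :=
  ⨆ a, C.innerCode a

/-- Errors of weight less than `d` to the quantum information are detected: if `φ ⊗ v_a` is sent
and the receiver, after projecting onto the outer code and measuring the message, reads off some
message `b`, then the quantum state is still `φ`. -/
def DetectsQuantum (C : HybridCode ι K μ) (d : ℕ) : Prop :=
  ∀ x z : ι → ZMod 2, weight x z < d → ∀ a b φ,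
    ∃ r : ℂ, (C.innerCode b).starProjection (opX x (opZ z (C.enc a φ))) = r • C.enc b φ

/-- Errors of weight less than `c` to the classical information are detected: a message `b`
different from the message `a` that was sent is never read off. -/
def DetectsClassical (C : HybridCode ι K μ) (c : ℕ) : Prop :=
  ∀ x z : ι → ZMod 2, weight x z < c → ∀ a b, a ≠ b → ∀ φ,
    (C.innerCode b).starProjection (opX x (opZ z (C.enc a φ))) = 0

/-- The code encodes `k` qubits and `m` classical bits into `N` qubits and detects all errors of
weight less than `d` to the quantum information and less than `c` to the classical information. -/
structure HasParameters (C : HybridCode ι K μ) (N k m d c : ℕ) : Prop where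
  length : Fintype.card ι = N
  quantum : K = 2 ^ k
  classical : Nat.card μ = 2 ^ m
  detectsQuantum : C.DetectsQuantum d
  detectsClassical : C.DetectsClassical c

/-- A hybrid stabilizer code: the outer code and all inner codes are stabilizer codes. -/
def IsStabilizer (C : HybridCode ι K μ) : Prop :=
  IsStabilizerCode C.outerCode ∧ ∀ a, IsStabilizerCode (C.innerCode a)

end HybridCode

/-! ### The trivial construction -/

section Trivial

variable {ι κ : Type} [Fintype ι] [DecidableEq ι] [Fintype κ] [DecidableEq κ]

/-- `ψ ↦ ψ ⊗ |w⟩`. -/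
def tensorKet (w : κ → ZMod 2) : Qubits ι →ₗ[ℂ] Qubits (ι ⊕ κ) where
  toFun ψ := WithLp.toLp 2 fun x =>
    if (fun j => x (Sum.inr j)) = w then ψ (fun i => x (Sum.inl i)) else 0
  map_add' ψ χ := by ext x; by_cases h : (fun j => x (Sum.inr j)) = w <;> simp [h]
  map_smul' r ψ := by ext x; by_cases h : (fun j => x (Sum.inr j)) = w <;> simp [h]

theorem inner_tensorKet (w v : κ → ZMod 2) (ψ χ : Qubits ι) :
    inner ℂ (tensorKet w ψ) (tensorKet v χ) = if w = v then inner ℂ ψ χ else 0 := by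
  simp only [PiLp.inner_apply, tensorKet, LinearMap.coe_mk, AddHom.coe_mk]
  rw [← (Equiv.sumArrowEquivProdArrow ι κ (ZMod 2)).symm.sum_comp, Fintype.sum_prod_type]
  by_cases h : w = v
  · subst h
    simp only [if_true]
    refine Finset.sum_congr rfl fun x _ => ?_
    rw [Finset.sum_eq_single w]
    · simp [Equiv.sumArrowEquivProdArrow]
    · intro y _ hy
      simp [Equiv.sumArrowEquivProdArrow, hy]
    · simp
  · rw [if_neg h]
    refine Finset.sum_eq_zero fun x _ => Finset.sum_eq_zero fun y _ => ?_
    by_cases hy : y = w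
    · subst hy
      simp [Equiv.sumArrowEquivProdArrow, h]
    · simp [Equiv.sumArrowEquivProdArrow, hy]

/-- The hybrid code that encodes the quantum state by `V` into the qubits `ι` and the classical
message by `w` into the remaining qubits `κ`. -/
def trivialHybrid {K : ℕ} {μ : Type} (V : EuclideanSpace ℂ (Fin K) →ₗᵢ[ℂ] Qubits ι)
    (w : μ ↪ (κ → ZMod 2)) : HybridCode (ι ⊕ κ) K μ where
  enc a := ((tensorKet (w a)).comp V.toLinearMap).isometryOfInner fun φ χ => by
    simp [inner_tensorKet]
  orthogonal a b hab φ χ := by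
    have h : w a ≠ w b := fun h => hab (w.injective h)
    simp [inner_tensorKet, h]

end Trivial

/-! ### Subsystem codes and gauge fixing -/

section Gauge

variable {ι : Type} [Fintype ι] [DecidableEq ι]

/-- The stabilizer group `S` and the gauge group `G` form a subsystem code with `r` gauge qubits,
and `(gz i, gx i)` are pairs of gauge operators generating `G` together with `S` and the scalars. -/
structure IsGaugeBasis (S G : Subgroup (Op ι)) {r : ℕ} (gz gx : Fin r → Op ι) : Prop where
  isStabilizerGroup : IsStabilizerGroup S
  gauge_le : G ≤ errorGroup ι
  stab_comm : ∀ s ∈ S, ∀ g ∈ G, s * g = g * s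
  gauge_eq : G = Subgroup.closure ({opI} ∪ S ∪ Set.range gz ∪ Set.range gx)
  comm_zz : ∀ i j, gz i * gz j = gz j * gz i
  comm_xx : ∀ i j, gx i * gx j = gx j * gx i
  comm_zx : ∀ i j, i ≠ j → gz i * gx j = gx j * gz i
  anticomm : ∀ i, gz i * gx i = opNeg * (gx i * gz i)

/-- The hybrid code `C` is obtained from the subsystem code with stabilizer group `S` and gauge
group `G` by gauge fixing: the outer code is the code of `S`; for the message `a` the gauge
operators `gz i` are fixed with the signs `(-1)^{a i}`; and the encoders of the different messages
differ by the translation operators `∏ i, (gx i)^{a i}`. -/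
def IsGaugeFixing (S G : Subgroup (Op ι)) {K r : ℕ}
    (C : HybridCode ι K (Fin r → ZMod 2)) : Prop :=
  ∃ gz gx : Fin r → Op ι, IsGaugeBasis S G gz gx ∧
    C.outerCode = fixedSpace S ∧
    (∀ a, C.innerCode a = fixedSpace
      (Subgroup.closure (S ∪ Set.range fun i => opNeg ^ (a i).val * gz i))) ∧
    (∀ a φ, C.enc a φ = (List.ofFn fun i => gx i ^ (a i).val).prod (C.enc 0 φ))

end Gauge

/-! ### The Bacon–Shor subsystem codes -/

/-- The stabilizer group of the Bacon–Shor code on the `n × n` lattice of qubits, generated by the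
operators acting as `Z` on two full rows, or as `X` on two full columns. -/
def baconShorStab (n : ℕ) : Subgroup (Op (Fin n × Fin n)) :=
  Subgroup.closure
    ({g | ∃ i i' : Fin n, i ≠ i' ∧ g = opZ fun p => if p.1 = i ∨ p.1 = i' then 1 else 0} ∪
     {g | ∃ j j' : Fin n, j ≠ j' ∧ g = opX fun p => if p.2 = j ∨ p.2 = j' then 1 else 0})

/-- The gauge group of the Bacon–Shor code, generated by the scalars, the operators `Z ⊗ Z` on two
qubits of the same column and the operators `X ⊗ X` on two qubits of the same row. -/
def baconShorGauge (n : ℕ) : Subgroup (Op (Fin n × Fin n)) :=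
  Subgroup.closure
    ({opI} ∪
     {g | ∃ i i' j : Fin n, i ≠ i' ∧
        g = opZ fun p => if p = (i, j) ∨ p = (i', j) then 1 else 0} ∪
     {g | ∃ i j j' : Fin n, j ≠ j' ∧
        g = opX fun p => if p = (i, j) ∨ p = (i, j') then 1 else 0})

end HybridBS

end

noncomputable section

namespace HybridBS


/-! ### Pauli operators -/

/-! Every operator in play is `X(x)Z(z)` for binary `n × n` matrices `x`, `z`, and commutation is
the parity of a dot product. The stabilizers are `Z` of row-constant and `X` of column-constant
matrices with evenly many nonzero lines; the gauge group consists, up to scalars, of products of `Z`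
of matrices with even columns and `X` of matrices with even rows. The pairs `zVec q`, `xVec q` are
dual bases of the gauge spaces modulo stabilizers (`zVec_dotProduct_xVec`, `RowEven.exists_eq`).

Fixing all `Z` gauge operators to `+1` leaves states supported on column-constant words, and the `X`
stabilizers then make the amplitude depend on the row parity only, so one qubit remains
(`exists_baseEnc_eq`). Translating by combinations of the `xVec q` realizes every sign pattern of
the `Z` gauges, hence all inner codes.

An error of weight below `n` misses a row and a column. If `x` has an odd row or `z` an odd column,
pairing that line with the missed one gives a stabilizer anticommuting with the error, so all matrix
elements between codewords vanish. Otherwise the error is a gauge operator, which only permutes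
messages up to scalars (`detection_cases`, `exists_opX_opZ_enc`). A nontrivial gauge operator has
weight at least 2, whence the classical distance. `X` on a column and `X(xVec q)` show that both
distances are sharp.

For the trivial construction, a Singleton bound gives `2(n-1) < n₁` and puncturing gives `(n-1)² <
n₂`; both are strict, so `n₁ + n₂` exceeds `n²`. The quantum bound compares bipartite matrices of
two orthogonal code states: with `M`, `M'` the matrices for a cut into two undetectable halves, `M
M* = M' M'*` and `M* M' = 0`, so `M' M'* M' = 0` and `M' = 0`. -/

/-- The character `s ↦ (-1)^s` of `𝔽₂`. -/
def sgn (s : ZMod 2) : ℂ := (-1) ^ s.val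

@[simp] theorem sgn_zero : sgn 0 = 1 := by simp [sgn]

@[simp] theorem sgn_one : sgn 1 = -1 := by simp [sgn, ZMod.val_one]

theorem zmod_two_cases (s : ZMod 2) : s = 0 ∨ s = 1 := by
  fin_cases s
  · exact Or.inl rfl
  · exact Or.inr rfl

theorem sgn_add (s t : ZMod 2) : sgn (s + t) = sgn s * sgn t := by
  rcases zmod_two_cases s with rfl | rfl <;> rcases zmod_two_cases t with rfl | rfl <;>
    simp [CharTwo.add_self_eq_zero]

theorem sgn_mul_self (s : ZMod 2) : sgn s * sgn s = 1 := by
  rw [← sgn_add, CharTwo.add_self_eq_zero, sgn_zero]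

theorem conj_sgn (s : ZMod 2) : (starRingEnd ℂ) (sgn s) = sgn s := by simp [sgn]

theorem add_add_cancel_left_two {α : Type*} (a b : α → ZMod 2) : a + (a + b) = b := by
  ext i; simp [← add_assoc, CharTwo.add_self_eq_zero]

theorem add_self_two {α : Type*} (a : α → ZMod 2) : a + a = 0 := by
  ext i; simp [CharTwo.add_self_eq_zero]

section Pauli

variable {ι : Type} [Fintype ι] [DecidableEq ι]

theorem opX_apply (a : ι → ZMod 2) (ψ : Qubits ι) (y : ι → ZMod 2) :
    opX a ψ y = ψ (y + a) := by
  have : y - a = y + a := by ext i; simp [CharTwo.sub_eq_add]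
  simp [opX, LinearIsometryEquiv.piLpCongrLeft_apply, Equiv.piCongrLeft', ← this, sub_eq_add_neg]

theorem opZ_apply (b : ι → ZMod 2) (ψ : Qubits ι) (y : ι → ZMod 2) :
    opZ b ψ y = sgn (b ⬝ᵥ y) * ψ y := rfl

theorem opI_apply (ψ : Qubits ι) : opI ψ = Complex.I • ψ := rfl

theorem opNeg_apply (ψ : Qubits ι) : opNeg ψ = -ψ := rfl

theorem opNeg_pow_apply (s : ZMod 2) (ψ : Qubits ι) : (opNeg ^ s.val) ψ = sgn s • ψ := by
  rcases zmod_two_cases s with rfl | rfl <;>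
    simp [ZMod.val_one, opNeg_apply]

@[simp] theorem opX_zero : opX (0 : ι → ZMod 2) = 1 := by
  ext ψ y; simp [opX_apply]

@[simp] theorem opZ_zero : opZ (0 : ι → ZMod 2) = 1 := by
  ext ψ y; simp [opZ_apply]

theorem opX_add (a b : ι → ZMod 2) : opX (a + b) = opX a * opX b := by
  ext ψ y; simp [opX_apply, add_assoc]

theorem opZ_add (a b : ι → ZMod 2) : opZ (a + b) = opZ a * opZ b := by
  ext ψ y; simp [opZ_apply, sgn_add, mul_assoc]

theorem opX_add_apply (a b : ι → ZMod 2) (ψ : Qubits ι) : opX (a + b) ψ = opX a (opX b ψ) := by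
  rw [opX_add]; rfl

theorem opX_comm (a b : ι → ZMod 2) : opX a * opX b = opX b * opX a := by
  rw [← opX_add, add_comm, opX_add]

theorem opZ_comm (a b : ι → ZMod 2) : opZ a * opZ b = opZ b * opZ a := by
  rw [← opZ_add, add_comm, opZ_add]

/-- All commutation and anticommutation relations between the two types of operators come from this
sign. -/
theorem opZ_opX_apply (b a : ι → ZMod 2) (ψ : Qubits ι) :
    opZ b (opX a ψ) = sgn (b ⬝ᵥ a) • opX a (opZ b ψ) := by
  ext y
  simp [opX_apply, opZ_apply, sgn_add]
  linear_combination (-sgn (b ⬝ᵥ y) * ψ (y + a)) * sgn_mul_self (b ⬝ᵥ a)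

theorem opZ_opX_comm {b a : ι → ZMod 2} (h : b ⬝ᵥ a = 0) : opZ b * opX a = opX a * opZ b := by
  ext1 ψ
  simpa [h] using opZ_opX_apply b a ψ

theorem opX_pow (a : ι → ZMod 2) (s : ZMod 2) : opX a ^ s.val = opX (s • a) := by
  rcases zmod_two_cases s with rfl | rfl <;> simp [ZMod.val_one]

theorem prod_opX {r : ℕ} (f : Fin r → ι → ZMod 2) (a : Fin r → ZMod 2) :
    (List.ofFn fun i => opX (f i) ^ (a i).val).prod = opX (∑ i, a i • f i) := by
  induction r with
  | zero => simp
  | succ r ih => rw [List.ofFn_succ, List.prod_cons, ih, Fin.sum_univ_succ, opX_add, opX_pow]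

/-- The vectors `a` with `X(a)` in a given group. -/
def xVectors (H : Subgroup (Op ι)) : AddSubgroup (ι → ZMod 2) where
  carrier := {a | opX a ∈ H}
  add_mem' ha hb := by
    simp only [Set.mem_ofPred_eq, opX_add] at *
    exact H.mul_mem ha hb
  zero_mem' := by simp [H.one_mem]
  neg_mem' {a} ha := by
    have : -a = a := by ext; simp [CharTwo.neg_eq]
    rwa [this]

/-- The vectors `b` with `Z(b)` in a given group. -/
def zVectors (H : Subgroup (Op ι)) : AddSubgroup (ι → ZMod 2) where
  carrier := {a | opZ a ∈ H}
  add_mem' ha hb := by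
    simp only [Set.mem_ofPred_eq, opZ_add] at *
    exact H.mul_mem ha hb
  zero_mem' := by simp [H.one_mem]
  neg_mem' {a} ha := by
    have : -a = a := by ext; simp [CharTwo.neg_eq]
    rwa [this]

theorem mem_xVectors {H : Subgroup (Op ι)} {a : ι → ZMod 2} : a ∈ xVectors H ↔ opX a ∈ H := Iff.rfl

theorem mem_zVectors {H : Subgroup (Op ι)} {a : ι → ZMod 2} : a ∈ zVectors H ↔ opZ a ∈ H := Iff.rfl

theorem opX_mem_errorGroup (a : ι → ZMod 2) : opX a ∈ errorGroup ι :=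
  Subgroup.subset_closure (Or.inl (Or.inr ⟨a, rfl⟩))

theorem opZ_mem_errorGroup (a : ι → ZMod 2) : opZ a ∈ errorGroup ι :=
  Subgroup.subset_closure (Or.inr ⟨a, rfl⟩)

theorem opI_mem_errorGroup : (opI : Op ι) ∈ errorGroup ι :=
  Subgroup.subset_closure (Or.inl (Or.inl rfl))

theorem opI_mul_opI : (opI * opI : Op ι) = opNeg := by
  ext ψ y; simp [opI_apply, opNeg_apply, smul_smul]

theorem opNeg_mem_errorGroup : (opNeg : Op ι) ∈ errorGroup ι := by
  rw [← opI_mul_opI]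
  exact mul_mem opI_mem_errorGroup opI_mem_errorGroup

theorem opI_comm (g : Op ι) : opI * g = g * opI := by
  ext1 ψ; simp [opI_apply]

theorem opNeg_comm (g : Op ι) : opNeg * g = g * opNeg := by
  ext1 ψ; simp [opNeg_apply]

theorem opNeg_pow_mul_comm {g h : Op ι} (hgh : g * h = h * g) (k : ℕ) :
    opNeg ^ k * g * h = h * (opNeg ^ k * g) := by
  have h1 : Commute (opNeg : Op ι) h := opNeg_comm h
  exact ((h1.pow_left k).mul_left hgh)

theorem inner_opX_opX (a : ι → ZMod 2) (χ ψ : Qubits ι) :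
    inner ℂ (opX a χ) (opX a ψ) = inner ℂ χ ψ := by
  simp only [PiLp.inner_apply, opX_apply]
  exact Equiv.sum_comp (Equiv.addRight a) fun y => inner ℂ (χ y) (ψ y)

theorem inner_opZ_opZ (a : ι → ZMod 2) (χ ψ : Qubits ι) :
    inner ℂ (opZ a χ) (opZ a ψ) = inner ℂ χ ψ := by
  simp only [PiLp.inner_apply, opZ_apply]
  refine Finset.sum_congr rfl fun y _ => ?_
  simp [conj_sgn]
  linear_combination (ψ y * (starRingEnd ℂ) (χ y)) * sgn_mul_self (a ⬝ᵥ y)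

/-! ### Joint fixed spaces -/

theorem mem_fixedSpace_closure {T : Set (Op ι)} {ψ : Qubits ι} :
    ψ ∈ fixedSpace (Subgroup.closure T) ↔ ∀ g ∈ T, g ψ = ψ := by
  refine ⟨fun h g hg => h g (Subgroup.subset_closure hg), fun h g hg => ?_⟩
  induction hg using Subgroup.closure_induction with
  | mem g hg => exact h g hg
  | one => rfl
  | mul a b _ _ ha hb => rw [LinearEquiv.mul_apply, hb, ha]
  | inv a _ ha => 
    conv_lhs => rw [← ha]
    rw [← LinearEquiv.mul_apply, inv_mul_cancel]; rfl

/-- Centralizers are subgroups, so commutation extends from generators first in one argument and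
then in the other. -/
theorem commute_closure {T U : Set (Op ι)} (h : ∀ g ∈ T, ∀ k ∈ U, g * k = k * g) :
    ∀ g ∈ Subgroup.closure T, ∀ k ∈ Subgroup.closure U, g * k = k * g := by
  have h1 : Subgroup.closure U ≤ Subgroup.centralizer T := by
    rw [Subgroup.closure_le]
    intro k hk
    exact Subgroup.mem_centralizer_iff.2 fun g hg => h g hg k hk
  have h2 : Subgroup.closure T ≤ Subgroup.centralizer (Subgroup.closure U) := by
    rw [Subgroup.closure_le]
    intro g hg
    exact Subgroup.mem_centralizer_iff.2 fun k hk =>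
      (Subgroup.mem_centralizer_iff.1 (h1 hk) g hg).symm
  intro g hg k hk
  exact (Subgroup.mem_centralizer_iff.1 (h2 hg) k hk).symm

/-- Commuting error operators with a nonzero common fixed vector generate a stabilizer group. -/
theorem isStabilizerGroup_closure {T : Set (Op ι)} (hT : T ⊆ errorGroup ι)
    (hcomm : ∀ g ∈ T, ∀ h ∈ T, g * h = h * g) {ψ : Qubits ι} (hψ : ψ ≠ 0)
    (hfix : ∀ g ∈ T, g ψ = ψ) : IsStabilizerGroup (Subgroup.closure T) where
  le_errorGroup := (Subgroup.closure_le _).2 hT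
  comm := commute_closure hcomm
  scalar_free g hg := by
    rintro ⟨r, hr⟩
    -- A scalar in the group must fix the nonzero vector `ψ`, which rules out everything but 1.
    have h1 : r • ψ = (1 : ℂ) • ψ := by
      rw [← hr, one_smul, mem_fixedSpace_closure.2 hfix g hg]
    have h2 : r = 1 := smul_left_injective ℂ hψ h1
    ext1 χ
    rw [hr, h2, one_smul]; rfl

end Pauli


/-! ### The quantum Singleton bound for codes of dimension at least two -/

section Singleton

variable {ι : Type} [DecidableEq ι]

/-- The restriction of a word to a set of positions, extended by zero. -/
def restrict (A : Finset ι) (v : ι → ZMod 2) : ι → ZMod 2 := A.piecewise v 0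

theorem restrict_apply (A : Finset ι) (v : ι → ZMod 2) (i : ι) :
    restrict A v i = if i ∈ A then v i else 0 := rfl

theorem restrict_add (A : Finset ι) (v w : ι → ZMod 2) :
    restrict A (v + w) = restrict A v + restrict A w := by
  ext i; by_cases h : i ∈ A <;> simp [restrict_apply, h]

theorem restrict_restrict (A : Finset ι) (v : ι → ZMod 2) :
    restrict A (restrict A v) = restrict A v := by
  ext i; by_cases h : i ∈ A <;> simp [restrict_apply, h]

variable [Fintype ι]

theorem restrict_dotProduct (A : Finset ι) (v w : ι → ZMod 2) :
    restrict A v ⬝ᵥ w = v ⬝ᵥ restrict A w := by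
  refine Finset.sum_congr rfl fun i _ => ?_
  by_cases h : i ∈ A <;> simp [restrict_apply, h]

theorem restrict_add_restrict_compl (A : Finset ι) (v : ι → ZMod 2) :
    restrict A v + restrict Aᶜ v = v := by
  ext i; by_cases h : i ∈ A <;> simp [restrict_apply, h]

theorem restrict_restrict_compl (A : Finset ι) (v : ι → ZMod 2) :
    restrict A (restrict Aᶜ v) = 0 := by
  ext i; by_cases h : i ∈ A <;> simp [restrict_apply, h]

theorem weight_le_card {A : Finset ι} {x z : ι → ZMod 2} (hx : restrict A x = x)
    (hz : restrict A z = z) : weight x z ≤ A.card := by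
  refine Finset.card_le_card fun i hi => ?_
  by_contra h
  rw [← hx, ← hz] at hi
  simp [restrict_apply, h] at hi

theorem inner_opX_opZ (χ ψ : Qubits ι) (x z : ι → ZMod 2) :
    inner ℂ χ (opX x (opZ z ψ)) =
      ∑ w, sgn (z ⬝ᵥ w) * ((starRingEnd ℂ) (χ (w + x)) * ψ w) := by
  simp only [PiLp.inner_apply, opX_apply, opZ_apply]
  rw [← Equiv.sum_comp (Equiv.addRight x)]
  refine Finset.sum_congr rfl fun w _ => ?_
  have : w + x + x = w := by rw [add_assoc, add_self_two, add_zero]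
  simp only [Equiv.coe_addRight, this, RCLike.inner_apply]
  ring

theorem sum_sgn_dotProduct (v : ι → ZMod 2) :
    ∑ z : ι → ZMod 2, sgn (z ⬝ᵥ v) = if v = 0 then (2 : ℂ) ^ Fintype.card ι else 0 := by
  split_ifs with h
  · subst h
    simp [ZMod.card]
  · obtain ⟨j, hj⟩ := Function.ne_iff.1 h
    have hj1 : v j = 1 := (zmod_two_cases (v j)).resolve_left hj
    have : ∑ z : ι → ZMod 2, sgn (z ⬝ᵥ v) = -∑ z : ι → ZMod 2, sgn (z ⬝ᵥ v) := by
      -- Translating `z` at a position where `v` is nonzero flips every sign.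
      conv_lhs => rw [← Equiv.sum_comp (Equiv.addRight (Pi.single j (1 : ZMod 2)))]
      simp [sgn_add, hj1]
    exact self_eq_neg.1 this

/-- The reduced operators of `|ψ⟩⟨χ|` on `A` are determined by the expectations of the Pauli
operators supported on `A`. -/
theorem sum_inner_restrict (A : Finset ι) (χ ψ : Qubits ι) (x y : ι → ZMod 2) :
    ∑ z, sgn (restrict A z ⬝ᵥ y) * inner ℂ χ (opX x (opZ (restrict A z) ψ)) =
      2 ^ Fintype.card ι * ∑ c, if restrict A c = 0 then
        (starRingEnd ℂ) (χ (c + y + x)) * ψ (c + y) else 0 := by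
  simp only [inner_opX_opZ, Finset.mul_sum]
  -- With the words written as `c + y`, the sum over `z` is a character sum that keeps only the `c`
  -- vanishing on `A`.
  rw [Finset.sum_comm, ← Equiv.sum_comp (Equiv.addRight y)]
  refine Finset.sum_congr rfl fun c _ => ?_
  simp only [Equiv.coe_addRight, ← mul_assoc, ← sgn_add, ← dotProduct_add]
  have h (z : ι → ZMod 2) : restrict A z ⬝ᵥ (y + (c + y)) = z ⬝ᵥ restrict A c := by
    rw [add_comm c y, add_add_cancel_left_two, restrict_dotProduct]
  simp only [h, ← Finset.sum_mul, sum_sgn_dotProduct]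
  split_ifs <;> ring

/-- The bipartite matrix of a state with respect to the splitting of the qubits into `A` and its
complement. -/
def splitMatrix (A : Finset ι) (ψ : Qubits ι) :
    Matrix (ι → ZMod 2) (ι → ZMod 2) ℂ := fun a b =>
  if restrict Aᶜ a = 0 ∧ restrict A b = 0 then ψ (a + b) else 0

theorem splitMatrix_eq_zero {A : Finset ι} {ψ : Qubits ι} (h : splitMatrix A ψ = 0) : ψ = 0 := by
  ext y
  have h1 := congrFun (congrFun h (restrict A y)) (restrict Aᶜ y)
  have h2 := restrict_restrict_compl Aᶜ y
  rw [compl_compl] at h2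
  simpa [splitMatrix, restrict_restrict_compl, h2, restrict_add_restrict_compl] using h1

theorem restrict_eq_self_of_compl {A : Finset ι} {a : ι → ZMod 2} (h : restrict Aᶜ a = 0) :
    restrict A a = a := by
  simpa [h] using restrict_add_restrict_compl A a

/-- This product is the partial trace of `|ψ⟩⟨χ|` over the complement of `A`. Its entries are
Fourier transforms of matrix elements of Pauli operators supported on `A`, since `a + a'` is
supported there too. -/
theorem splitMatrix_mul_conjTranspose (A : Finset ι) (χ ψ : Qubits ι) (a a' : ι → ZMod 2) :
    (splitMatrix A ψ * (splitMatrix A χ).conjTranspose) a a' =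
      if restrict Aᶜ a = 0 ∧ restrict Aᶜ a' = 0 then
        ((2 : ℂ) ^ Fintype.card ι)⁻¹ * ∑ z, sgn (restrict A z ⬝ᵥ a) *
          inner ℂ χ (opX (a + a') (opZ (restrict A z) ψ)) else 0 := by
  rw [sum_inner_restrict, inv_mul_cancel_left₀ (pow_ne_zero _ two_ne_zero), Matrix.mul_apply]
  by_cases h : restrict Aᶜ a = 0 ∧ restrict Aᶜ a' = 0
  · rw [if_pos h]
    refine Finset.sum_congr rfl fun c _ => ?_
    have e1 : c + a + (a + a') = a' + c := by
      rw [add_assoc, add_add_cancel_left_two, add_comm]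
    by_cases hc : restrict A c = 0
    · simp [splitMatrix, h, hc, e1, add_comm a c]
      ring
    · simp [splitMatrix, hc]
  · rw [if_neg h]
    refine Finset.sum_eq_zero fun c _ => ?_
    rcases not_and_or.1 h with h | h <;> simp [splitMatrix, h]

/-- The same computation with the factors exchanged traces out `A` instead. -/
theorem conjTranspose_mul_splitMatrix (A : Finset ι) (χ ψ : Qubits ι) (b b' : ι → ZMod 2) :
    ((splitMatrix A χ).conjTranspose * splitMatrix A ψ) b b' =
      if restrict A b = 0 ∧ restrict A b' = 0 then
        ((2 : ℂ) ^ Fintype.card ι)⁻¹ * ∑ z, sgn (restrict Aᶜ z ⬝ᵥ b') *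
          inner ℂ χ (opX (b' + b) (opZ (restrict Aᶜ z) ψ)) else 0 := by
  rw [sum_inner_restrict, inv_mul_cancel_left₀ (pow_ne_zero _ two_ne_zero), Matrix.mul_apply]
  by_cases h : restrict A b = 0 ∧ restrict A b' = 0
  · rw [if_pos h]
    refine Finset.sum_congr rfl fun c _ => ?_
    have e1 : c + b' + (b' + b) = c + b := by
      rw [add_assoc, add_add_cancel_left_two]
    by_cases hc : restrict Aᶜ c = 0
    · simp [splitMatrix, h, hc, e1]
    · simp [splitMatrix, hc]
  · rw [if_neg h]
    refine Finset.sum_eq_zero fun c _ => ?_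
    rcases not_and_or.1 h with h | h <;> simp [splitMatrix, h]

open scoped ComplexOrder in
/-- If the errors of weight less than `d` do not distinguish two orthogonal states, in the sense
of the Knill–Laflamme conditions, then there are more than `2 (d - 1)` qubits. -/
theorem two_mul_lt_card {d : ℕ} (hd : 0 < d) (ψ χ : Qubits ι) (hχ : χ ≠ 0)
    (hoff : ∀ x z, weight x z < d → inner ℂ ψ (opX x (opZ z χ)) = 0)
    (hdiag : ∀ x z, weight x z < d →
      inner ℂ ψ (opX x (opZ z ψ)) = inner ℂ χ (opX x (opZ z χ))) :
    2 * (d - 1) < Fintype.card ι := by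
  by_contra! hcard
  -- When there are at most `2(d-1)` qubits, they split into two sets of at most `d-1`. The minimum
  -- covers the case of fewer than `d-1` qubits in total.
  obtain ⟨A, hA1, hA2⟩ : ∃ A : Finset ι, A.card < d ∧ Aᶜ.card < d := by
    obtain ⟨A, -, hA⟩ := Finset.exists_subset_card_eq
      (s := (Finset.univ : Finset ι)) (n := min (d - 1) (Fintype.card ι))
      (by simp [Finset.card_univ])
    refine ⟨A, by omega, ?_⟩
    rw [Finset.card_compl]
    omega
  have hw {B : Finset ι} (hB : B.card < d) {x z : ι → ZMod 2} (hx : restrict B x = x) :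
      weight x (restrict B z) < d :=
    (weight_le_card hx (restrict_restrict B z)).trans_lt hB
  -- Errors on `A` do not tell the states apart, so the reduced states on `A` agree.
  have h1 : splitMatrix A ψ * (splitMatrix A ψ).conjTranspose =
      splitMatrix A χ * (splitMatrix A χ).conjTranspose := by
    ext a a'
    rw [splitMatrix_mul_conjTranspose, splitMatrix_mul_conjTranspose]
    refine if_ctx_congr Iff.rfl (fun h => ?_) fun _ => rfl
    congr 1
    refine Finset.sum_congr rfl fun z _ => ?_
    rw [hdiag _ _ (hw hA1 _)]
    rw [restrict_add, restrict_eq_self_of_compl h.1, restrict_eq_self_of_compl h.2]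
  -- Errors on the complement of `A` do not connect the two states.
  have h2 : (splitMatrix A ψ).conjTranspose * splitMatrix A χ = 0 := by
    ext b b'
    rw [conjTranspose_mul_splitMatrix]
    split_ifs with h
    · have h3 {b : ι → ZMod 2} (hb : restrict A b = 0) : restrict Aᶜ b = b :=
        restrict_eq_self_of_compl (by rwa [compl_compl])
      rw [Finset.sum_eq_zero, mul_zero]; rfl
      intro z _
      rw [hoff _ _ (hw hA2 _), mul_zero]
      rw [restrict_add, h3 h.1, h3 h.2]
    · rfl
  have h3 : splitMatrix A χ * (splitMatrix A χ).conjTranspose * splitMatrix A χ = 0 := by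
    rw [← h1, Matrix.mul_assoc, h2, Matrix.mul_zero]
  rw [Matrix.self_mul_conjTranspose_mul_eq_zero, Matrix.conjTranspose_mul_self_eq_zero] at h3
  exact hχ (splitMatrix_eq_zero h3)

/-- The Singleton bound for quantum codes of dimension at least two. -/
theorem IsQuantumCode.two_mul_lt_card {C : Submodule ℂ (Qubits ι)} {K d : ℕ}
    (h : IsQuantumCode C K d) (hK : 2 ≤ K) (hd : 0 < d) : 2 * (d - 1) < Fintype.card ι := by
  let B := stdOrthonormalBasis ℂ C
  have hK' : 2 ≤ Module.finrank ℂ C := h.finrank_eq ▸ hK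
  let i0 : Fin (Module.finrank ℂ C) := ⟨0, by omega⟩
  let i1 : Fin (Module.finrank ℂ C) := ⟨1, by omega⟩
  have h01 : i0 ≠ i1 := by simp [i0, i1]
  have horth : inner ℂ (B i0 : Qubits ι) (B i1 : Qubits ι) = 0 := B.orthonormal.2 h01
  have hn (i) : inner ℂ (B i : Qubits ι) (B i : Qubits ι) = 1 :=
    (inner_self_eq_one_of_norm_eq_one (𝕜 := ℂ) (B.orthonormal.1 i))
  have hproj (χ : C) (v : Qubits ι) :
      inner ℂ (χ : Qubits ι) (C.starProjection v) = inner ℂ (χ : Qubits ι) v := by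
    rw [← Submodule.inner_starProjection_left_eq_right,
      Submodule.starProjection_eq_self_iff.2 χ.2]
  refine HybridBS.two_mul_lt_card hd (B i0 : Qubits ι) (B i1) ?_ (fun x z hw => ?_)
    fun x z hw => ?_
  · intro h0
    simpa [h0] using hn i1
  · obtain ⟨r, hr⟩ := h.detects x z hw (B i1) (B i1).2
    rw [← hproj, hr, inner_smul_right, horth, mul_zero]
  · obtain ⟨r0, h0⟩ := h.detects x z hw (B i0) (B i0).2
    obtain ⟨r1, h1⟩ := h.detects x z hw (B i1) (B i1).2
    -- The scalar may depend on the state; detection on the sum forces the scalars of both basis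
    -- vectors to equal `r2`.
    obtain ⟨r2, h2⟩ := h.detects x z hw (B i0 + B i1) (B i0 + B i1).2
    rw [map_add, map_add, map_add, h0, h1, smul_add] at h2
    have horth' : inner ℂ (B i1 : Qubits ι) (B i0 : Qubits ι) = 0 := B.orthonormal.2 h01.symm
    have e0 := congrArg (inner ℂ (B i0 : Qubits ι)) h2
    have e1 := congrArg (inner ℂ (B i1 : Qubits ι)) h2
    simp only [inner_add_right, inner_smul_right, horth, horth', hn] at e0 e1
    rw [← hproj (B i0), ← hproj (B i1), h0, h1, inner_smul_right, inner_smul_right, hn, hn]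
    linear_combination e0 - e1

/-- The Singleton bound for classical codes of distance two. -/
theorem IsClassicalCode.lt_length {n k : ℕ} {D : Finset (Fin n → ZMod 2)} (hk : 0 < k)
    (h : IsClassicalCode D (2 ^ k) 2) : k < n := by
  cases n with
  | zero =>
    have h1 : D.card ≤ 1 := Finset.card_le_one_of_subsingleton D
    have h2 : 2 ^ 1 ≤ 2 ^ k := Nat.pow_le_pow_right (by norm_num) hk
    have := h.card_eq
    omega
  | succ t =>
    -- Puncturing at the first position is injective, because codewords that agree elsewhere are at
    -- distance at most 1.
    have hinj : Set.InjOn (fun x : Fin (t + 1) → ZMod 2 => Fin.tail x) D := by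
      intro x hx y hy hxy
      by_contra hne
      have h1 := h.le_dist x hx y hy hne
      have h2 : hammingDist x y ≤ 1 := by
        refine (Finset.card_le_card (t := {0}) fun i hi => ?_).trans (Finset.card_singleton _).le
        rw [Finset.mem_singleton]
        by_contra hi0
        obtain ⟨j, rfl⟩ := Fin.exists_succ_eq.2 hi0
        exact (Finset.mem_filter.1 hi).2 (congrFun hxy j)
      omega
    have h1 := Finset.card_le_card_of_injOn _ (t := Finset.univ) (fun _ _ => Finset.mem_univ _) hinj
    rw [h.card_eq, Finset.card_univ, Fintype.card_fun, ZMod.card, Fintype.card_fin] at h1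
    have := (Nat.pow_le_pow_iff_right (by norm_num)).1 h1
    omega

end Singleton

/-! ### The trivial construction -/

section Trivial

theorem weight_elim {ι κ : Type} [Fintype ι] [Fintype κ] (x z : ι → ZMod 2) (u : κ → ZMod 2) :
    weight (Sum.elim x u) (Sum.elim z 0) = weight x z + hammingNorm u := by
  simp only [weight, hammingNorm, Finset.card_filter, Fintype.sum_sum_type, Sum.elim_inl,
    Sum.elim_inr, Pi.zero_apply, ne_eq, not_true_eq_false, or_false]
  congr!

variable {ι κ : Type} [Fintype ι] [DecidableEq ι] [Fintype κ] [DecidableEq κ]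

/-- Bit flips on the classical register only change its word, so errors act on the two registers
independently. -/
theorem opX_opZ_tensorKet (x z : ι → ZMod 2) (u w : κ → ZMod 2) (ψ : Qubits ι) :
    opX (Sum.elim x u) (opZ (Sum.elim z 0) (tensorKet w ψ)) =
      tensorKet (w + u) (opX x (opZ z ψ)) := by
  ext y
  simp only [opX_apply, opZ_apply, tensorKet, LinearMap.coe_mk, AddHom.coe_mk, dotProduct,
    Fintype.sum_sum_type, Sum.elim_inl, Sum.elim_inr, Pi.add_apply, Pi.zero_apply, zero_mul,
    Finset.sum_const_zero, add_zero]
  have : ((fun j => y (Sum.inr j) + u j) = w) ↔ ((fun j => y (Sum.inr j)) = w + u) := by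
    constructor
    · rintro rfl
      ext j; simp [add_assoc, CharTwo.add_self_eq_zero]
    · intro h
      ext j
      have := congrFun h j
      simp [this, add_assoc, CharTwo.add_self_eq_zero]
  simp only [this]
  split_ifs
  · rfl
  · simp

/-- The quantum ingredient of the trivial construction inherits the quantum distance. -/
theorem isQuantumCode_of_trivialHybrid {K d : ℕ} {μ : Type} [Nonempty μ]
    {V : EuclideanSpace ℂ (Fin K) →ₗᵢ[ℂ] Qubits ι} {w : μ ↪ (κ → ZMod 2)}
    (h : (trivialHybrid V w).DetectsQuantum d) :
    IsQuantumCode (LinearMap.range V.toLinearMap) K d where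
  finrank_eq := by
    rw [LinearMap.finrank_range_of_inj V.injective]
    simp
  detects x z hw := by
    rintro _ ⟨φ, rfl⟩
    obtain ⟨a⟩ := ‹Nonempty μ›
    obtain ⟨r, hr⟩ := h (Sum.elim x 0) (Sum.elim z 0) (by simpa [weight_elim] using hw) a a φ
    refine ⟨r, ?_⟩
    have henc (χ) : (trivialHybrid V w).enc a χ = tensorKet (w a) (V χ) := rfl
    apply Submodule.eq_starProjection_of_mem_of_inner_eq_zero
      (Submodule.smul_mem _ r (LinearMap.mem_range_self V.toLinearMap φ))
    rintro _ ⟨χ, rfl⟩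
    have h1 := Submodule.starProjection_inner_eq_zero (K := (trivialHybrid V w).innerCode a)
      (opX (Sum.elim x 0) (opZ (Sum.elim z 0) ((trivialHybrid V w).enc a φ)))
      ((trivialHybrid V w).enc a χ) ⟨χ, rfl⟩
    rw [hr, henc, henc, opX_opZ_tensorKet, add_zero, ← map_smul, ← map_sub, inner_tensorKet,
      if_pos rfl] at h1
    exact h1

/-- The classical ingredient of the trivial construction inherits the classical distance. -/
theorem isClassicalCode_of_trivialHybrid {K c : ℕ} {μ : Type} [Fintype μ] (hK : 0 < K)
    {V : EuclideanSpace ℂ (Fin K) →ₗᵢ[ℂ] Qubits ι} {w : μ ↪ (κ → ZMod 2)}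
    (h : (trivialHybrid V w).DetectsClassical c) :
    IsClassicalCode (Finset.univ.map w) (Fintype.card μ) c where
  card_eq := by simp
  le_dist x hx y hy hne := by
    obtain ⟨a, -, rfl⟩ := Finset.mem_map.1 hx
    obtain ⟨b, -, rfl⟩ := Finset.mem_map.1 hy
    by_contra! hlt
    have hab : a ≠ b := fun hab => hne (by rw [hab])
    let φ : EuclideanSpace ℂ (Fin K) := EuclideanSpace.single ⟨0, hK⟩ 1
    -- Flipping the bits where the two words differ turns message `a` into message `b`, at the cost
    -- of their Hamming distance.
    have h1 := h (Sum.elim 0 (w a + w b)) (Sum.elim 0 0) (by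
      rw [weight_elim]
      have : w a + w b = -w a + w b := by ext; simp [CharTwo.neg_eq]
      rw [this, ← hammingDist_eq_hammingNorm]
      simpa [weight] using hlt) a b hab φ
    have henc (e χ) : (trivialHybrid V w).enc e χ = tensorKet (w e) (V χ) := rfl
    rw [henc, opX_opZ_tensorKet, add_add_cancel_left_two, opX_zero, opZ_zero] at h1
    have h2 := Submodule.starProjection_eq_self_iff.2
      (show (trivialHybrid V w).enc b φ ∈ (trivialHybrid V w).innerCode b from ⟨φ, rfl⟩)
    have h3 : (trivialHybrid V w).enc b φ = 0 := h2.symm.trans h1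
    have h4 : φ = 0 := (trivialHybrid V w).enc b |>.injective (by rw [h3, map_zero])
    simpa [φ] using congrArg norm h4

end Trivial


/-! ### Binary matrices -/

section Matrices

variable {m : ℕ}

/-- The binary words indexed by an `(m + 1) × (m + 1)` lattice. -/
abbrev Lattice (m : ℕ) : Type := Fin (m + 1) × Fin (m + 1) → ZMod 2

/-- The word that is constant along rows. -/
def rowVec (u : Fin (m + 1) → ZMod 2) : Lattice m := fun p => u p.1

/-- The word that is constant along columns. -/
def colVec (t : Fin (m + 1) → ZMod 2) : Lattice m := fun p => t p.2

/-- Every row has even parity. -/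
def RowEven (x : Lattice m) : Prop := ∀ i, ∑ j, x (i, j) = 0

/-- Every column has even parity. -/
def ColEven (z : Lattice m) : Prop := ∀ j, ∑ i, z (i, j) = 0

theorem rowEven_comp_swap {z : Lattice m} : RowEven (z ∘ Prod.swap) ↔ ColEven z := Iff.rfl

theorem colVec_comp_swap (t : Fin (m + 1) → ZMod 2) : colVec t ∘ Prod.swap = rowVec t := rfl

theorem colVec_add (t s : Fin (m + 1) → ZMod 2) : colVec (t + s) = colVec t + colVec s := rfl

theorem RowEven.add {x y : Lattice m} (hx : RowEven x) (hy : RowEven y) : RowEven (x + y) := by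
  intro i
  simp [Finset.sum_add_distrib, hx i, hy i]

theorem comp_swap_dotProduct (x y : Lattice m) : (x ∘ Prod.swap) ⬝ᵥ y = x ⬝ᵥ (y ∘ Prod.swap) := by
  simp only [dotProduct]
  rw [← (Equiv.prodComm (Fin (m + 1)) (Fin (m + 1))).sum_comp]
  rfl

theorem rowVec_dotProduct (u : Fin (m + 1) → ZMod 2) (x : Lattice m) :
    rowVec u ⬝ᵥ x = ∑ i, u i * ∑ j, x (i, j) := by
  simp only [dotProduct, rowVec, Fintype.sum_prod_type, Finset.mul_sum]

theorem dotProduct_colVec (z : Lattice m) (t : Fin (m + 1) → ZMod 2) :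
    z ⬝ᵥ colVec t = ∑ j, (∑ i, z (i, j)) * t j := by
  simp only [dotProduct, colVec, Fintype.sum_prod_type_right, Finset.sum_mul]

theorem RowEven.rowVec_dotProduct {x : Lattice m} (hx : RowEven x) (u : Fin (m + 1) → ZMod 2) :
    rowVec u ⬝ᵥ x = 0 := by
  rw [HybridBS.rowVec_dotProduct]
  exact Finset.sum_eq_zero fun i _ => by rw [hx i, mul_zero]

theorem ColEven.dotProduct_colVec {z : Lattice m} (hz : ColEven z) (t : Fin (m + 1) → ZMod 2) :
    z ⬝ᵥ colVec t = 0 := by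
  rw [HybridBS.dotProduct_colVec]
  exact Finset.sum_eq_zero fun i _ => by rw [hz i, zero_mul]

theorem rowEven_colVec {t : Fin (m + 1) → ZMod 2} (ht : ∑ j, t j = 0) : RowEven (colVec t) :=
  fun _ => ht

theorem colEven_rowVec {u : Fin (m + 1) → ZMod 2} (hu : ∑ i, u i = 0) : ColEven (rowVec u) :=
  fun _ => hu

/-- The two ends of a pair of qubits in the same row, one of them in the last column. -/
def xVec (q : Fin m × Fin m) : Lattice m :=
  Pi.single (q.1.castSucc, q.2.castSucc) 1 + Pi.single (q.1.castSucc, Fin.last m) 1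

/-- The two ends of a pair of qubits in the same column, one of them in the last row. -/
def zVec (q : Fin m × Fin m) : Lattice m := xVec q.swap ∘ Prod.swap

theorem rowEven_xVec (q : Fin m × Fin m) : RowEven (xVec q) := by
  intro i
  simp only [xVec, Pi.add_apply, Finset.sum_add_distrib, Pi.single_apply, Prod.mk.injEq]
  by_cases h : i = q.1.castSucc
  · simp [h, CharTwo.add_self_eq_zero]
  · simp [h]

theorem colEven_zVec (q : Fin m × Fin m) : ColEven (zVec q) :=
  rowEven_xVec q.swap

/-- The ends in the last row and in the last column never lie on the other pair, so only the
interior sites `p` and `q` can coincide. -/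
theorem zVec_dotProduct_xVec (p q : Fin m × Fin m) :
    zVec p ⬝ᵥ xVec q = if p = q then 1 else 0 := by
  have h1 (i : Fin m) : Fin.last m ≠ i.castSucc := (Fin.castSucc_lt_last i).ne'
  rw [xVec, dotProduct_add, dotProduct_single_one, dotProduct_single_one]
  obtain ⟨a, b⟩ := p
  obtain ⟨c, d⟩ := q
  simp only [zVec, xVec, Function.comp_apply, Prod.swap_prod_mk, Pi.add_apply, Pi.single_apply,
    Prod.mk.injEq, h1, (h1 _).symm, Fin.castSucc_inj, and_false, false_and, if_false, add_zero,
    eq_comm (a := c), eq_comm (a := d), and_comm (a := b = d)]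

theorem sum_smul_xVec_apply (a : Fin m × Fin m → ZMod 2) (i j : Fin (m + 1)) :
    (∑ q, a q • xVec q) (i, j) =
      Fin.lastCases 0 (fun k => Fin.lastCases (∑ l, a (k, l)) (fun l => a (k, l)) j) i := by
  have h1 (i : Fin m) : Fin.last m ≠ i.castSucc := (Fin.castSucc_lt_last i).ne'
  simp only [Finset.sum_apply, Pi.smul_apply, xVec, Pi.add_apply, Pi.single_apply, Prod.mk.injEq,
    smul_eq_mul, Fintype.sum_prod_type]
  induction i using Fin.lastCases with
  | last => simp [h1]
  | cast k =>
    induction j using Fin.lastCases with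
    | last => simp [h1, Finset.sum_ite_irrel]
    | cast l => simp [(h1 _).symm, ite_and, Finset.sum_ite_irrel]

/-- Modulo pairs of columns, the pairs of qubits `xVec q` span the words with even rows. -/
theorem RowEven.exists_eq {x : Lattice m} (hx : RowEven x) :
    ∃ (t : Fin (m + 1) → ZMod 2) (a : Fin m × Fin m → ZMod 2), ∑ j, t j = 0 ∧
      x = colVec t + ∑ q, a q • xVec q := by
  -- Subtracting the last row from every row leaves a matrix with even rows and zero last row, which
  -- is determined by its interior entries.
  refine ⟨fun j => x (Fin.last m, j),
    fun q => x (q.1.castSucc, q.2.castSucc) + x (Fin.last m, q.2.castSucc), hx _, ?_⟩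
  have hl (i) : ∑ l : Fin m, x (i, l.castSucc) = x (i, Fin.last m) := by
    have := hx i
    rw [Fin.sum_univ_castSucc] at this
    exact CharTwo.add_eq_zero.1 this
  ext ⟨i, j⟩
  rw [Pi.add_apply, sum_smul_xVec_apply]
  induction i using Fin.lastCases with
  | last => simp [colVec]
  | cast k =>
    induction j using Fin.lastCases with
    | last =>
      simp [colVec, Finset.sum_add_distrib, hl]
      rw [add_left_comm, CharTwo.add_self_eq_zero, add_zero]
    | cast l =>
      simp [colVec]
      rw [add_left_comm, CharTwo.add_self_eq_zero, add_zero]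

theorem sum_smul_comp_swap (b : Fin m × Fin m → ZMod 2) :
    (∑ q, b q • xVec q) ∘ Prod.swap = ∑ q, b q.swap • zVec q := by
  rw [← (Equiv.prodComm (Fin m) (Fin m)).sum_comp]
  ext p
  simp [zVec]

/-- Modulo pairs of rows, the pairs of qubits `zVec q` span the words with even columns. -/
theorem ColEven.exists_eq {z : Lattice m} (hz : ColEven z) :
    ∃ (u : Fin (m + 1) → ZMod 2) (b : Fin m × Fin m → ZMod 2), ∑ i, u i = 0 ∧
      z = rowVec u + ∑ q, b q • zVec q := by
  obtain ⟨t, a, ht, h⟩ := RowEven.exists_eq (rowEven_comp_swap.2 hz)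
  refine ⟨t, fun q => a q.swap, ht, ?_⟩
  rw [← sum_smul_comp_swap, ← colVec_comp_swap]
  exact congrArg (· ∘ Prod.swap) h

theorem zmod_two_smul_mem {α : Type*} (T : AddSubgroup (α → ZMod 2)) (s : ZMod 2) {x : α → ZMod 2}
    (hx : x ∈ T) : s • x ∈ T := by
  rcases zmod_two_cases s with rfl | rfl
  · simp [T.zero_mem]
  · simpa using hx

/-- A group of words containing the pairs of columns and the words `xVec q` contains every word
with even rows. -/
theorem RowEven.mem_of_xVec {T : AddSubgroup (Lattice m)}
    (hc : ∀ t : Fin (m + 1) → ZMod 2, ∑ j, t j = 0 → colVec t ∈ T) (hq : ∀ q, xVec q ∈ T)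
    {x : Lattice m} (hx : RowEven x) : x ∈ T := by
  obtain ⟨t, a, ht, rfl⟩ := hx.exists_eq
  exact T.add_mem (hc t ht) (T.sum_mem fun q _ => zmod_two_smul_mem T _ (hq q))

/-- A group of words containing the pairs of rows and the words `zVec q` contains every word
with even columns. -/
theorem ColEven.mem_of_zVec {T : AddSubgroup (Lattice m)}
    (hr : ∀ u : Fin (m + 1) → ZMod 2, ∑ i, u i = 0 → rowVec u ∈ T) (hq : ∀ q, zVec q ∈ T)
    {z : Lattice m} (hz : ColEven z) : z ∈ T := by
  obtain ⟨u, b, hu, rfl⟩ := hz.exists_eq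
  exact T.add_mem (hr u hu) (T.sum_mem fun q _ => zmod_two_smul_mem T _ (hq q))

/-- The pairs of columns span the words that are constant along columns and have even rows. -/
theorem colVec_mem {T : AddSubgroup (Lattice m)}
    (h : ∀ j j' : Fin (m + 1), j ≠ j' → colVec (Pi.single j 1 + Pi.single j' 1) ∈ T)
    {t : Fin (m + 1) → ZMod 2} (ht : ∑ j, t j = 0) : colVec t ∈ T := by
  -- Since `t` has even sum, the added copies of the last column cancel.
  have h1 : colVec t = ∑ j, t j • colVec (Pi.single j 1 + Pi.single (Fin.last m) 1) := by
    ext p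
    simp only [colVec, Finset.sum_apply, Pi.smul_apply, Pi.add_apply, smul_eq_mul, mul_add,
      Finset.sum_add_distrib, ← Finset.sum_mul, ht, Pi.single_apply]
    simp
  rw [h1]
  refine T.sum_mem fun j _ => zmod_two_smul_mem T _ ?_
  by_cases hj : j = Fin.last m
  · rw [hj, add_self_two]; exact T.zero_mem
  · exact h _ _ hj

/-- The pairs of rows span the words that are constant along rows and have even columns. -/
theorem rowVec_mem {T : AddSubgroup (Lattice m)}
    (h : ∀ i i' : Fin (m + 1), i ≠ i' → rowVec (Pi.single i 1 + Pi.single i' 1) ∈ T)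
    {u : Fin (m + 1) → ZMod 2} (hu : ∑ i, u i = 0) : rowVec u ∈ T :=
  -- Transposition of the lattice exchanges rows and columns.
  colVec_mem (T := T.comap (AddMonoidHom.mk' (fun x : Lattice m => x ∘ Prod.swap) fun _ _ => rfl))
    h hu

/-- The pairs of qubits in the same row span the words with even rows. -/
theorem RowEven.mem {T : AddSubgroup (Lattice m)}
    (h : ∀ i j j' : Fin (m + 1), j ≠ j' → Pi.single (i, j) 1 + Pi.single (i, j') 1 ∈ T)
    {x : Lattice m} (hx : RowEven x) : x ∈ T := by
  have h1 : x = ∑ p : Fin (m + 1) × Fin (m + 1),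
      x p • (Pi.single p 1 + Pi.single (p.1, Fin.last m) 1 : Lattice m) := by
    ext ⟨i, j⟩
    simp only [Finset.sum_apply, Pi.smul_apply, Pi.add_apply, smul_eq_mul, mul_add,
      Finset.sum_add_distrib, Pi.single_apply, Fintype.sum_prod_type, Prod.mk.injEq]
    simp only [ite_and, mul_ite, mul_one, mul_zero, Finset.sum_ite_irrel, Finset.sum_const_zero,
      Finset.sum_ite_eq, Finset.mem_univ, if_true]
    by_cases hj : j = Fin.last m
    · simp [hj, hx i]
    · simp [hj]
  rw [h1]
  refine T.sum_mem fun p _ => zmod_two_smul_mem T _ ?_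
  obtain ⟨i, j⟩ := p
  by_cases hj : j = Fin.last m
  · rw [hj, add_self_two]; exact T.zero_mem
  · exact h _ _ _ hj

/-- The pairs of qubits in the same column span the words with even columns. -/
theorem ColEven.mem {T : AddSubgroup (Lattice m)}
    (h : ∀ i i' j : Fin (m + 1), i ≠ i' → Pi.single (i, j) 1 + Pi.single (i', j) 1 ∈ T)
    {z : Lattice m} (hz : ColEven z) : z ∈ T := by
  have h1 := RowEven.mem
    (T := T.comap (AddMonoidHom.mk' (fun x : Lattice m => x ∘ Prod.swap) fun _ _ => rfl))
    (fun i j j' hj => ?_) (rowEven_comp_swap.2 hz)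
  · exact h1
  · have h2 (j : Fin (m + 1)) : (Pi.single (i, j) 1 : Lattice m) ∘ Prod.swap =
        Pi.single (j, i) 1 := by
      ext ⟨a, b⟩
      simp [Pi.single_apply, and_comm]
    change (Pi.single (i, j) 1 : Lattice m) ∘ Prod.swap + (Pi.single (i, j') 1 : Lattice m) ∘
      Prod.swap ∈ T
    rw [h2, h2]
    exact h _ _ _ hj

/-! ### The Bacon–Shor groups -/

/-- Enlarging the generators from pairs of lines to all even sets of lines turns membership into a
linear parity condition. -/
theorem baconShorStab_eq (m : ℕ) : baconShorStab (m + 1) = Subgroup.closure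
    (opZ '' (rowVec '' {u | ∑ i, u i = 0}) ∪ opX '' (colVec '' {t | ∑ j, t j = 0})) := by
  have hpair (i i' : Fin (m + 1)) : ∑ k, (Pi.single i 1 + Pi.single i' 1 : _ → ZMod 2) k = 0 := by
    simp [Finset.sum_add_distrib, CharTwo.add_self_eq_zero]
  have hrow (i i' : Fin (m + 1)) (h : i ≠ i') :
      (fun p : Fin (m + 1) × Fin (m + 1) => if p.1 = i ∨ p.1 = i' then (1 : ZMod 2) else 0) =
        rowVec (Pi.single i 1 + Pi.single i' 1) := by
    ext p
    by_cases h1 : p.1 = i <;> by_cases h2 : p.1 = i' <;>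
      simp_all [rowVec, Pi.single_apply]
  have hcol (i i' : Fin (m + 1)) (h : i ≠ i') :
      (fun p : Fin (m + 1) × Fin (m + 1) => if p.2 = i ∨ p.2 = i' then (1 : ZMod 2) else 0) =
        colVec (Pi.single i 1 + Pi.single i' 1) :=
    congrArg (· ∘ Prod.swap) (hrow i i' h)
  apply le_antisymm <;> rw [baconShorStab, Subgroup.closure_le]
  · rintro g (⟨i, i', h, rfl⟩ | ⟨i, i', h, rfl⟩)
    · rw [hrow i i' h]
      exact Subgroup.subset_closure (Or.inl ⟨_, ⟨_, hpair i i', rfl⟩, rfl⟩)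
    · rw [hcol i i' h]
      exact Subgroup.subset_closure (Or.inr ⟨_, ⟨_, hpair i i', rfl⟩, rfl⟩)
  · rintro g (⟨_, ⟨u, hu, rfl⟩, rfl⟩ | ⟨_, ⟨u, hu, rfl⟩, rfl⟩)
    · refine mem_zVectors.1 (rowVec_mem (fun i i' h => mem_zVectors.2 ?_) hu)
      exact Subgroup.subset_closure (Or.inl ⟨i, i', h, by rw [hrow i i' h]⟩)
    · refine mem_xVectors.1 (colVec_mem (fun i i' h => mem_xVectors.2 ?_) hu)
      exact Subgroup.subset_closure (Or.inr ⟨i, i', h, by rw [hcol i i' h]⟩)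

theorem baconShorGauge_eq (m : ℕ) : baconShorGauge (m + 1) = Subgroup.closure
    ({opI} ∪ opZ '' {z : Lattice m | ColEven z} ∪ opX '' {x : Lattice m | RowEven x}) := by
  have hpair (p q : Fin (m + 1) × Fin (m + 1)) (h : p ≠ q) :
      (fun r : Fin (m + 1) × Fin (m + 1) => if r = p ∨ r = q then (1 : ZMod 2) else 0) =
        Pi.single p 1 + Pi.single q 1 := by
    ext r
    by_cases h1 : r = p <;> by_cases h2 : r = q <;>
      simp_all
  have hrow (i j j' : Fin (m + 1)) :
      RowEven (Pi.single (i, j) 1 + Pi.single (i, j') 1 : Lattice m) := by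
    intro k
    by_cases h : k = i <;>
      simp [h, Pi.single_apply, Finset.sum_add_distrib, CharTwo.add_self_eq_zero]
  have hcol (i i' j : Fin (m + 1)) :
      ColEven (Pi.single (i, j) 1 + Pi.single (i', j) 1 : Lattice m) := by
    intro k
    by_cases h : k = j <;>
      simp [h, Pi.single_apply, Finset.sum_add_distrib, CharTwo.add_self_eq_zero]
  apply le_antisymm <;> rw [baconShorGauge, Subgroup.closure_le]
  · rintro g ((rfl | ⟨i, i', j, h, rfl⟩) | ⟨i, j, j', h, rfl⟩)
    · exact Subgroup.subset_closure (Or.inl (Or.inl rfl))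
    · rw [hpair _ _ (by simpa using h)]
      exact Subgroup.subset_closure (Or.inl (Or.inr ⟨_, hcol i i' j, rfl⟩))
    · rw [hpair _ _ (by simpa using h)]
      exact Subgroup.subset_closure (Or.inr ⟨_, hrow i j j', rfl⟩)
  · rintro g ((rfl | ⟨z, hz, rfl⟩) | ⟨x, hx, rfl⟩)
    · exact Subgroup.subset_closure (Or.inl (Or.inl rfl))
    · refine mem_zVectors.1 (ColEven.mem (fun i i' j h => mem_zVectors.2 ?_) hz)
      exact Subgroup.subset_closure
        (Or.inl (Or.inr ⟨i, i', j, h, by rw [hpair _ _ (by simpa using h)]⟩))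
    · refine mem_xVectors.1 (RowEven.mem (fun i j j' h => mem_xVectors.2 ?_) hx)
      exact Subgroup.subset_closure
        (Or.inr ⟨i, j, j', h, by rw [hpair _ _ (by simpa using h)]⟩)

end Matrices


/-! ### The hybrid Bacon–Shor code -/

section BaconShor

variable {m r : ℕ}

/-- The labels of the basis of the logical qubit. -/
def bit : ZMod 2 ≃ Fin (2 ^ 1) := Fintype.equivOfCardEq (by simp [ZMod.card])

/-- The normalization of the logical states. -/
def normConst (m : ℕ) : ℂ := ((Real.sqrt (2 ^ m))⁻¹ : ℝ)

theorem normConst_ne_zero (m : ℕ) : normConst m ≠ 0 := by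
  simp [normConst]

theorem normConst_sq (m : ℕ) : normConst m * (starRingEnd ℂ) (normConst m) * 2 ^ m = 1 := by
  rw [normConst, Complex.conj_ofReal, ← Complex.ofReal_mul, ← mul_inv,
    Real.mul_self_sqrt (by positivity)]
  push_cast
  exact inv_mul_cancel₀ (pow_ne_zero _ two_ne_zero)

/-- The encoder of the logical qubit for the message `0`: the state `|s⟩` becomes the uniform
superposition of the words that are constant along columns and have rows of parity `s`. -/
def baseEnc (m : ℕ) :
    EuclideanSpace ℂ (Fin (2 ^ 1)) →ₗ[ℂ] Qubits (Fin (m + 1) × Fin (m + 1)) where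
  toFun φ := WithLp.toLp 2 fun y : Lattice m =>
    if y = colVec (fun j => y (0, j)) then normConst m * φ (bit (∑ j, y (0, j))) else 0
  map_add' φ χ := by
    ext y
    by_cases h : y = colVec (fun j => y (0, j))
    · simp only [if_pos h, PiLp.add_apply]; ring
    · simp only [if_neg h, PiLp.add_apply]; simp
  map_smul' s φ := by
    ext y
    by_cases h : y = colVec (fun j => y (0, j))
    · simp only [if_pos h, PiLp.smul_apply, smul_eq_mul, RingHom.id_apply]; ring
    · simp only [if_neg h, PiLp.smul_apply]; simp

theorem baseEnc_colVec (φ : EuclideanSpace ℂ (Fin (2 ^ 1))) (t : Fin (m + 1) → ZMod 2) :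
    baseEnc m φ (colVec t) = normConst m * φ (bit (∑ j, t j)) := if_pos rfl

theorem baseEnc_of_ne (φ : EuclideanSpace ℂ (Fin (2 ^ 1))) {y : Lattice m}
    (h : ∀ t, y ≠ colVec t) : baseEnc m φ y = 0 := if_neg (h _)

/-- For fixed remaining coordinates, the first one runs once through each parity, so each parity
occurs `2 ^ m` times. -/
theorem sum_parity (f : ZMod 2 → ℂ) :
    ∑ t : Fin (m + 1) → ZMod 2, f (∑ j, t j) = 2 ^ m * ∑ s, f s := by
  rw [← (Fin.consEquiv fun _ : Fin (m + 1) => ZMod 2).sum_comp, Fintype.sum_prod_type_right]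
  have h (t : Fin m → ZMod 2) : ∑ s, f (s + ∑ j, t j) = ∑ s, f s :=
    Equiv.sum_comp (Equiv.addRight (∑ j, t j)) f
  simp [Fin.consEquiv, Fin.sum_univ_succ, h, ZMod.card]

theorem sum_ite_colVec (f : (Fin (m + 1) → ZMod 2) → ℂ) :
    ∑ y : Lattice m, (if y = colVec (fun j => y (0, j)) then f (fun j => y (0, j)) else 0) =
      ∑ t, f t := by
  rw [← Finset.sum_filter]
  refine Finset.sum_nbij' (fun y j => y (0, j)) colVec (by simp) (fun t _ => ?_) (fun y hy => ?_)
    (fun t _ => rfl) fun y _ => rfl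
  · exact Finset.mem_filter.2 ⟨Finset.mem_univ _, rfl⟩
  · exact (Finset.mem_filter.1 hy).2.symm

theorem inner_baseEnc (φ χ : EuclideanSpace ℂ (Fin (2 ^ 1))) :
    inner ℂ (baseEnc m φ) (baseEnc m χ) = inner ℂ φ χ := by
  let f (t : Fin (m + 1) → ZMod 2) : ℂ :=
    inner ℂ (normConst m * φ (bit (∑ j, t j))) (normConst m * χ (bit (∑ j, t j)))
  have h (y : Lattice m) : inner ℂ (baseEnc m φ y) (baseEnc m χ y) =
      if y = colVec (fun j => y (0, j)) then f (fun j => y (0, j)) else 0 := by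
    split_ifs with hy
    · rw [hy, baseEnc_colVec, baseEnc_colVec]; rfl
    · rw [baseEnc_of_ne φ fun t ht => hy (by rw [ht]; rfl), inner_zero_left]
  rw [PiLp.inner_apply, Finset.sum_congr rfl fun y _ => h y, sum_ite_colVec f,
    sum_parity fun s => inner ℂ (normConst m * φ (bit s)) (normConst m * χ (bit s)),
    PiLp.inner_apply, ← bit.sum_comp, Finset.mul_sum]
  refine Finset.sum_congr rfl fun s _ => ?_
  simp only [RCLike.inner_apply, map_mul]
  linear_combination (χ (bit s) * (starRingEnd ℂ) (φ (bit s))) * normConst_sq m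

theorem opZ_baseEnc {z : Lattice m} (hz : ColEven z) (φ : EuclideanSpace ℂ (Fin (2 ^ 1))) :
    opZ z (baseEnc m φ) = baseEnc m φ := by
  ext y
  rw [opZ_apply]
  by_cases h : ∃ t, y = colVec t
  · obtain ⟨t, rfl⟩ := h
    rw [hz.dotProduct_colVec, sgn_zero, one_mul]
  · push Not at h
    rw [baseEnc_of_ne φ h, mul_zero]

theorem opX_baseEnc {t : Fin (m + 1) → ZMod 2} (ht : ∑ j, t j = 0)
    (φ : EuclideanSpace ℂ (Fin (2 ^ 1))) : opX (colVec t) (baseEnc m φ) = baseEnc m φ := by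
  ext y
  rw [opX_apply]
  by_cases h : ∃ t, y = colVec t
  · obtain ⟨s, rfl⟩ := h
    rw [← colVec_add, baseEnc_colVec, baseEnc_colVec]
    simp [Finset.sum_add_distrib, ht]
  · push Not at h
    rw [baseEnc_of_ne φ h, baseEnc_of_ne φ]
    intro s hs
    apply h (s + t)
    rw [colVec_add, ← hs, add_assoc, add_self_two, add_zero]

/-- `Z`-invariance kills the amplitudes off the column-constant words, and `X`-invariance identifies
amplitudes of equal parity. The logical amplitude is read off at the representative `Pi.single 0 s`
of its parity class. -/
theorem exists_baseEnc_eq {ψ : Qubits (Fin (m + 1) × Fin (m + 1))}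
    (hz : ∀ z : Lattice m, ColEven z → opZ z ψ = ψ)
    (hx : ∀ t : Fin (m + 1) → ZMod 2, ∑ j, t j = 0 → opX (colVec t) ψ = ψ) :
    ∃ φ, baseEnc m φ = ψ := by
  refine ⟨WithLp.toLp 2 fun s => (normConst m)⁻¹ * ψ (colVec (Pi.single 0 (bit.symm s))), ?_⟩
  ext y
  by_cases h : ∃ t, y = colVec t
  · obtain ⟨t, rfl⟩ := h
    rw [baseEnc_colVec, mul_inv_cancel_left₀ (normConst_ne_zero m), Equiv.symm_apply_apply]
    have h1 := congrArg (· (colVec t)) (hx (t + Pi.single 0 (∑ j, t j))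
      (by simp [Finset.sum_add_distrib, CharTwo.add_self_eq_zero]))
    simp only [opX_apply, ← colVec_add, add_add_cancel_left_two] at h1
    exact h1
  · push Not at h
    rw [baseEnc_of_ne _ h]
    have h0 := h fun j => y (0, j)
    obtain ⟨⟨i, j⟩, hp⟩ := Function.ne_iff.1 h0
    -- At a site where `y` deviates from its first row, the pair formed with the first-row site has
    -- sign `-1`, so the amplitude equals its negative.
    have hcol : ColEven (Pi.single (i, j) 1 + Pi.single (0, j) 1 : Lattice m) := by
      intro k
      by_cases h : k = j <;>
        simp [h, Pi.single_apply, Finset.sum_add_distrib, CharTwo.add_self_eq_zero]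
    have h1 := congrArg (· y) (hz _ hcol)
    have h2 : y (i, j) + y (0, j) = 1 :=
      (zmod_two_cases _).resolve_left fun h => hp (CharTwo.add_eq_zero.1 h)
    simp only [opZ_apply, add_dotProduct, single_one_dotProduct, h2, sgn_one] at h1
    linear_combination (1 / 2 : ℂ) * h1

/-- The translation vector of the message `a`. -/
def shift (e : Fin r ≃ Fin m × Fin m) (a : Fin r → ZMod 2) : Lattice m := ∑ i, a i • xVec (e i)

theorem zVec_dotProduct_shift (e : Fin r ≃ Fin m × Fin m) (a : Fin r → ZMod 2) (i : Fin r) :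
    zVec (e i) ⬝ᵥ shift e a = a i := by
  simp [shift, dotProduct_sum, zVec_dotProduct_xVec]

theorem rowEven_shift (e : Fin r ≃ Fin m × Fin m) (a : Fin r → ZMod 2) : RowEven (shift e a) := by
  intro i
  simp only [shift, Finset.sum_apply, Pi.smul_apply]
  rw [Finset.sum_comm]
  exact Finset.sum_eq_zero fun k _ => by rw [← Finset.smul_sum, rowEven_xVec, smul_zero]

/-- The hybrid code obtained from the Bacon–Shor code by fixing the gauge operators `Z(zVec q)`. -/
def baconShorHybrid (e : Fin r ≃ Fin m × Fin m) :
    HybridCode (Fin (m + 1) × Fin (m + 1)) (2 ^ 1) (Fin r → ZMod 2) where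
  enc a := ((opX (shift e a)).toLinearMap.comp (baseEnc m)).isometryOfInner fun φ χ =>
    (inner_opX_opX _ _ _).trans (inner_baseEnc φ χ)
  orthogonal a b hab φ χ := by
    obtain ⟨i, hi⟩ := Function.ne_iff.1 hab
    have hz (c : Fin r → ZMod 2) (φ : EuclideanSpace ℂ (Fin (2 ^ 1))) :
        opZ (zVec (e i)) (opX (shift e c) (baseEnc m φ)) =
          sgn (c i) • opX (shift e c) (baseEnc m φ) := by
      rw [opZ_opX_apply, opZ_baseEnc (colEven_zVec _), zVec_dotProduct_shift]
    -- A unitary acting with opposite signs on two vectors forces them to be orthogonal.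
    have h1 := inner_opZ_opZ (zVec (e i)) (opX (shift e a) (baseEnc m φ))
      (opX (shift e b) (baseEnc m χ))
    rw [hz, hz, inner_smul_left, inner_smul_right, conj_sgn, ← mul_assoc, ← sgn_add,
      (zmod_two_cases (a i + b i)).resolve_left fun h => hi (CharTwo.add_eq_zero.1 h), sgn_one]
      at h1
    simp only [LinearMap.isometryOfInner, LinearIsometry.coe_mk, LinearMap.comp_apply,
      LinearEquiv.coe_coe]
    linear_combination (-1 / 2 : ℂ) * h1

variable (e : Fin r ≃ Fin m × Fin m)

theorem enc_apply (a : Fin r → ZMod 2) (φ : EuclideanSpace ℂ (Fin (2 ^ 1))) :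
    (baconShorHybrid e).enc a φ = opX (shift e a) (baseEnc m φ) := rfl

theorem enc_zero_apply (φ : EuclideanSpace ℂ (Fin (2 ^ 1))) :
    (baconShorHybrid e).enc 0 φ = baseEnc m φ := by
  have h : shift e 0 = 0 := by simp [shift]
  rw [enc_apply, h, opX_zero]
  rfl

theorem opZ_enc {z : Lattice m} (hz : ColEven z) (a : Fin r → ZMod 2)
    (φ : EuclideanSpace ℂ (Fin (2 ^ 1))) :
    opZ z ((baconShorHybrid e).enc a φ) =
      sgn (z ⬝ᵥ shift e a) • (baconShorHybrid e).enc a φ := by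
  rw [enc_apply, opZ_opX_apply, opZ_baseEnc hz]

theorem opZ_rowVec_enc {u : Fin (m + 1) → ZMod 2} (hu : ∑ i, u i = 0) (a : Fin r → ZMod 2)
    (φ : EuclideanSpace ℂ (Fin (2 ^ 1))) :
    opZ (rowVec u) ((baconShorHybrid e).enc a φ) = (baconShorHybrid e).enc a φ := by
  rw [opZ_enc e (colEven_rowVec hu), (rowEven_shift e a).rowVec_dotProduct, sgn_zero, one_smul]

theorem opX_colVec_enc {t : Fin (m + 1) → ZMod 2} (ht : ∑ j, t j = 0) (a : Fin r → ZMod 2)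
    (φ : EuclideanSpace ℂ (Fin (2 ^ 1))) :
    opX (colVec t) ((baconShorHybrid e).enc a φ) = (baconShorHybrid e).enc a φ := by
  rw [enc_apply, ← opX_add_apply, add_comm (colVec t), opX_add_apply, opX_baseEnc ht]

theorem mem_fixedSpace_baconShorStab {ψ : Qubits (Fin (m + 1) × Fin (m + 1))} :
    ψ ∈ fixedSpace (baconShorStab (m + 1)) ↔
      (∀ u : Fin (m + 1) → ZMod 2, ∑ i, u i = 0 → opZ (rowVec u) ψ = ψ) ∧
      ∀ t : Fin (m + 1) → ZMod 2, ∑ j, t j = 0 → opX (colVec t) ψ = ψ := by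
  rw [baconShorStab_eq, mem_fixedSpace_closure]
  constructor
  · intro h
    exact ⟨fun u hu => h _ (Or.inl ⟨_, ⟨u, hu, rfl⟩, rfl⟩),
      fun t ht => h _ (Or.inr ⟨_, ⟨t, ht, rfl⟩, rfl⟩)⟩
  · rintro ⟨h1, h2⟩ _ (⟨_, ⟨u, hu, rfl⟩, rfl⟩ | ⟨_, ⟨t, ht, rfl⟩, rfl⟩)
    · exact h1 u hu
    · exact h2 t ht

theorem innerCode_le_fixedSpace (a : Fin r → ZMod 2) :
    (baconShorHybrid e).innerCode a ≤ fixedSpace (baconShorStab (m + 1)) := by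
  rintro _ ⟨φ, rfl⟩
  exact mem_fixedSpace_baconShorStab.2
    ⟨fun u hu => opZ_rowVec_enc e hu a φ, fun t ht => opX_colVec_enc e ht a φ⟩

/-- The inner codes are the joint eigenspaces of the stabilizers and the fixed gauge operators. -/
theorem mem_innerCode {a : Fin r → ZMod 2} {ψ : Qubits (Fin (m + 1) × Fin (m + 1))} :
    ψ ∈ (baconShorHybrid e).innerCode a ↔ ψ ∈ fixedSpace (baconShorStab (m + 1)) ∧
      ∀ i, opZ (zVec (e i)) ψ = sgn (a i) • ψ := by
  constructor
  · intro h
    refine ⟨innerCode_le_fixedSpace e a h, fun i => ?_⟩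
    obtain ⟨φ, rfl⟩ := h
    exact (opZ_enc e (colEven_zVec _) a φ).trans (by rw [zVec_dotProduct_shift]; rfl)
  · rintro ⟨hS, hz⟩
    obtain ⟨h1, h2⟩ := mem_fixedSpace_baconShorStab.1 hS
    -- Undoing the translation resets all gauge signs to `+1`, which reduces the claim to the code
    -- for message 0.
    let ψ' := opX (shift e a) ψ
    let H := Subgroup.closure (opZ '' (rowVec '' {u : Fin (m + 1) → ZMod 2 | ∑ i, u i = 0}) ∪
      Set.range fun q : Fin m × Fin m => opZ (zVec q))
    have hH : ψ' ∈ fixedSpace H := by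
      rw [mem_fixedSpace_closure]
      rintro _ (⟨_, ⟨u, hu, rfl⟩, rfl⟩ | ⟨q, rfl⟩)
      · simp only [ψ']
        rw [opZ_opX_apply, (rowEven_shift e a).rowVec_dotProduct, sgn_zero, one_smul, h1 u hu]
      · obtain ⟨i, rfl⟩ := e.surjective q
        simp only [ψ']
        rw [opZ_opX_apply, hz i, zVec_dotProduct_shift, map_smul, smul_smul, sgn_mul_self, one_smul]
    obtain ⟨φ, hφ⟩ := exists_baseEnc_eq (ψ := ψ')
      (fun z hz => hH _ (mem_zVectors.1 (ColEven.mem_of_zVec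
        (fun u hu => mem_zVectors.2 (Subgroup.subset_closure (Or.inl ⟨_, ⟨u, hu, rfl⟩, rfl⟩)))
        (fun q => mem_zVectors.2 (Subgroup.subset_closure (Or.inr ⟨q, rfl⟩))) hz)))
      (fun t ht => by
        simp only [ψ']
        rw [← opX_add_apply, add_comm (colVec t), opX_add_apply, h2 t ht])
    refine ⟨φ, ?_⟩
    change opX (shift e a) (baseEnc m φ) = ψ
    simp only [hφ, ψ', ← opX_add_apply, add_self_two, opX_zero]
    rfl

/-- A stabilized state is the sum of its parts with given gauge syndrome. Each part stays
stabilized: `Z` operators are diagonal, and translation along columns does not change the syndrome.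
-/
theorem outerCode_eq : (baconShorHybrid e).outerCode = fixedSpace (baconShorStab (m + 1)) := by
  refine le_antisymm (iSup_le (innerCode_le_fixedSpace e)) fun ψ hψ => ?_
  let part (a : Fin r → ZMod 2) : Qubits (Fin (m + 1) × Fin (m + 1)) :=
    WithLp.toLp 2 fun y : Lattice m => if (fun i => zVec (e i) ⬝ᵥ y) = a then ψ y else 0
  have hsum : ψ = ∑ a, part a := by
    ext y
    simp [part]
  rw [hsum]
  refine Submodule.sum_mem _ fun a _ => ?_
  refine Submodule.mem_iSup_of_mem a ((mem_innerCode e).2 ⟨?_, fun i => ?_⟩)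
  · obtain ⟨h1, h2⟩ := mem_fixedSpace_baconShorStab.1 hψ
    refine mem_fixedSpace_baconShorStab.2 ⟨fun u hu => ?_, fun t ht => ?_⟩
    · ext y
      have h3 := congrArg (· y) (h1 u hu)
      simp only [opZ_apply, part] at h3 ⊢
      split_ifs
      · exact h3
      · exact mul_zero _
    · ext y
      have h3 := congrArg (· y) (h2 t ht)
      simp only [opX_apply, part, dotProduct_add, (colEven_zVec _).dotProduct_colVec,
        add_zero] at h3 ⊢
      rw [h3]
  · ext y
    simp only [opZ_apply, part, PiLp.smul_apply, smul_eq_mul]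
    split_ifs with h
    · rw [← h]
    · rw [mul_zero, mul_zero]

/-- Supplies the nonzero fixed vector from which stabilizer groups are seen to be free of nontrivial
scalars. -/
theorem exists_mem_innerCode_ne_zero (a : Fin r → ZMod 2) :
    ∃ ψ ∈ (baconShorHybrid e).innerCode a, ψ ≠ 0 := by
  refine ⟨(baconShorHybrid e).enc a (EuclideanSpace.single 0 1), ⟨_, rfl⟩, fun h => ?_⟩
  have h1 : EuclideanSpace.single (0 : Fin (2 ^ 1)) (1 : ℂ) = 0 :=
    ((baconShorHybrid e).enc a).injective (by rw [h, map_zero])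
  simpa using congrArg norm h1

theorem isStabilizerGroup_baconShorStab (m : ℕ) : IsStabilizerGroup (baconShorStab (m + 1)) := by
  obtain ⟨ψ, hψ, hne⟩ := exists_mem_innerCode_ne_zero (finProdFinEquiv (m := m) (n := m)).symm 0
  have hfix := innerCode_le_fixedSpace _ _ hψ
  rw [baconShorStab_eq] at hfix ⊢
  refine isStabilizerGroup_closure ?_ ?_ hne (mem_fixedSpace_closure.1 hfix)
  · rintro _ (⟨z, -, rfl⟩ | ⟨x, -, rfl⟩)
    · exact opZ_mem_errorGroup z
    · exact opX_mem_errorGroup x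
  · rintro _ (⟨_, ⟨u, hu, rfl⟩, rfl⟩ | ⟨_, ⟨t, ht, rfl⟩, rfl⟩) _
      (⟨_, ⟨u', hu', rfl⟩, rfl⟩ | ⟨_, ⟨t', ht', rfl⟩, rfl⟩)
    · exact opZ_comm _ _
    · exact opZ_opX_comm ((rowEven_colVec ht').rowVec_dotProduct u)
    · exact (opZ_opX_comm ((rowEven_colVec ht).rowVec_dotProduct u')).symm
    · exact opX_comm _ _

theorem baconShorStab_comm_baconShorGauge {s g : Op (Fin (m + 1) × Fin (m + 1))}
    (hs : s ∈ baconShorStab (m + 1)) (hg : g ∈ baconShorGauge (m + 1)) : s * g = g * s := by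
  rw [baconShorStab_eq] at hs
  rw [baconShorGauge_eq] at hg
  refine commute_closure ?_ s hs g hg
  rintro _ (⟨_, ⟨u, hu, rfl⟩, rfl⟩ | ⟨_, ⟨t, ht, rfl⟩, rfl⟩) _
    ((rfl | ⟨z, hz, rfl⟩) | ⟨x, hx, rfl⟩)
  · exact (opI_comm _).symm
  · exact opZ_comm _ _
  · exact opZ_opX_comm (RowEven.rowVec_dotProduct hx u)
  · exact (opI_comm _).symm
  · exact (opZ_opX_comm (ColEven.dotProduct_colVec hz t)).symm
  · exact opX_comm _ _

theorem opZ_mem_baconShorGauge {z : Lattice m} (hz : ColEven z) :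
    opZ z ∈ baconShorGauge (m + 1) := by
  rw [baconShorGauge_eq]
  exact Subgroup.subset_closure (Or.inl (Or.inr ⟨z, hz, rfl⟩))

theorem opX_mem_baconShorGauge {x : Lattice m} (hx : RowEven x) :
    opX x ∈ baconShorGauge (m + 1) := by
  rw [baconShorGauge_eq]
  exact Subgroup.subset_closure (Or.inr ⟨x, hx, rfl⟩)

theorem opI_mem_baconShorGauge : opI ∈ baconShorGauge (m + 1) := by
  rw [baconShorGauge_eq]
  exact Subgroup.subset_closure (Or.inl (Or.inl rfl))

theorem opZ_rowVec_mem_baconShorStab {u : Fin (m + 1) → ZMod 2} (hu : ∑ i, u i = 0) :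
    opZ (rowVec u) ∈ baconShorStab (m + 1) := by
  rw [baconShorStab_eq]
  exact Subgroup.subset_closure (Or.inl ⟨_, ⟨u, hu, rfl⟩, rfl⟩)

theorem opX_colVec_mem_baconShorStab {t : Fin (m + 1) → ZMod 2} (ht : ∑ j, t j = 0) :
    opX (colVec t) ∈ baconShorStab (m + 1) := by
  rw [baconShorStab_eq]
  exact Subgroup.subset_closure (Or.inr ⟨_, ⟨t, ht, rfl⟩, rfl⟩)

theorem baconShorStab_le_baconShorGauge (m : ℕ) :
    baconShorStab (m + 1) ≤ baconShorGauge (m + 1) := by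
  rw [baconShorStab_eq, Subgroup.closure_le]
  rintro _ (⟨_, ⟨u, hu, rfl⟩, rfl⟩ | ⟨_, ⟨t, ht, rfl⟩, rfl⟩)
  · exact opZ_mem_baconShorGauge (colEven_rowVec hu)
  · exact opX_mem_baconShorGauge (rowEven_colVec ht)

theorem isGaugeBasis_baconShor : IsGaugeBasis (baconShorStab (m + 1)) (baconShorGauge (m + 1))
    (fun i => opZ (zVec (e i))) (fun i => opX (xVec (e i))) where
  isStabilizerGroup := isStabilizerGroup_baconShorStab m
  gauge_le := by
    rw [baconShorGauge_eq, Subgroup.closure_le]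
    rintro _ ((rfl | ⟨z, -, rfl⟩) | ⟨x, -, rfl⟩)
    · exact opI_mem_errorGroup
    · exact opZ_mem_errorGroup z
    · exact opX_mem_errorGroup x
  stab_comm _ hs _ hg := baconShorStab_comm_baconShorGauge hs hg
  gauge_eq := by
    apply le_antisymm
    · conv_lhs => rw [baconShorGauge_eq]
      rw [Subgroup.closure_le]
      rintro _ ((rfl | ⟨z, hz, rfl⟩) | ⟨x, hx, rfl⟩)
      · exact Subgroup.subset_closure (Or.inl (Or.inl (Or.inl rfl)))
      · refine mem_zVectors.1 (ColEven.mem_of_zVec (fun u hu => mem_zVectors.2 ?_)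
          (fun q => mem_zVectors.2 ?_) hz)
        · exact Subgroup.subset_closure (Or.inl (Or.inl (Or.inr (opZ_rowVec_mem_baconShorStab hu))))
        · exact Subgroup.subset_closure (Or.inl (Or.inr ⟨e.symm q, by simp⟩))
      · refine mem_xVectors.1 (RowEven.mem_of_xVec (fun t ht => mem_xVectors.2 ?_)
          (fun q => mem_xVectors.2 ?_) hx)
        · exact Subgroup.subset_closure (Or.inl (Or.inl (Or.inr (opX_colVec_mem_baconShorStab ht))))
        · exact Subgroup.subset_closure (Or.inr ⟨e.symm q, by simp⟩)
    · rw [Subgroup.closure_le]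
      rintro _ (((rfl | hs) | ⟨i, rfl⟩) | ⟨i, rfl⟩)
      · exact opI_mem_baconShorGauge
      · exact baconShorStab_le_baconShorGauge m hs
      · exact opZ_mem_baconShorGauge (colEven_zVec _)
      · exact opX_mem_baconShorGauge (rowEven_xVec _)
  comm_zz _ _ := opZ_comm _ _
  comm_xx _ _ := opX_comm _ _
  comm_zx i j hij := opZ_opX_comm (by rw [zVec_dotProduct_xVec, if_neg (e.injective.ne hij)])
  anticomm i := by
    ext1 ψ
    simp [opZ_opX_apply, zVec_dotProduct_xVec, opNeg_apply]

theorem innerCode_eq (a : Fin r → ZMod 2) : (baconShorHybrid e).innerCode a =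
    fixedSpace (Subgroup.closure (baconShorStab (m + 1) ∪
      Set.range fun i => opNeg ^ (a i).val * opZ (zVec (e i)))) := by
  ext ψ
  have h (i : Fin r) : (opNeg ^ (a i).val * opZ (zVec (e i)) : Op _) ψ = ψ ↔
      opZ (zVec (e i)) ψ = sgn (a i) • ψ := by
    rw [LinearEquiv.mul_apply, opNeg_pow_apply]
    constructor <;> intro h
    · conv_rhs => rw [← h]
      rw [smul_smul, sgn_mul_self, one_smul]
    · rw [h, smul_smul, sgn_mul_self, one_smul]
  rw [mem_innerCode, mem_fixedSpace_closure]
  constructor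
  · rintro ⟨h1, h2⟩ _ (hs | ⟨i, rfl⟩)
    · exact h1 _ hs
    · exact (h i).2 (h2 i)
  · exact fun h1 => ⟨fun g hg => h1 g (Or.inl hg), fun i => (h i).1 (h1 _ (Or.inr ⟨i, rfl⟩))⟩

theorem isGaugeFixing_baconShorHybrid :
    IsGaugeFixing (baconShorStab (m + 1)) (baconShorGauge (m + 1)) (baconShorHybrid e) := by
  refine ⟨_, _, isGaugeBasis_baconShor e, outerCode_eq e, innerCode_eq e, fun a φ => ?_⟩
  rw [prod_opX, enc_zero_apply]
  rfl

theorem isStabilizer_baconShorHybrid : (baconShorHybrid e).IsStabilizer := by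
  have hS := isStabilizerGroup_baconShorStab m
  refine ⟨⟨_, hS, outerCode_eq e⟩, fun a => ⟨_, ?_, innerCode_eq e a⟩⟩
  obtain ⟨ψ, hψ, hne⟩ := exists_mem_innerCode_ne_zero e a
  rw [innerCode_eq] at hψ
  have hgz (s) (hs : s ∈ baconShorStab (m + 1)) (i : Fin r) :
      opNeg ^ (a i).val * opZ (zVec (e i)) * s = s * (opNeg ^ (a i).val * opZ (zVec (e i))) :=
    opNeg_pow_mul_comm (baconShorStab_comm_baconShorGauge hs
      (opZ_mem_baconShorGauge (colEven_zVec _))).symm _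
  refine isStabilizerGroup_closure ?_ ?_ hne (mem_fixedSpace_closure.1 hψ)
  · rintro _ (hs | ⟨i, rfl⟩)
    · exact hS.le_errorGroup hs
    · exact mul_mem (pow_mem opNeg_mem_errorGroup _) (opZ_mem_errorGroup _)
  · rintro g (hs | ⟨i, rfl⟩) k (hk | ⟨j, rfl⟩)
    · exact hS.comm g hs k hk
    · exact (hgz g hs j).symm
    · exact hgz k hk i
    · exact opNeg_pow_mul_comm (opNeg_pow_mul_comm (opZ_comm _ _) _).symm _

end BaconShor


/-! ### Exact quantum and classical distances of the code -/

section Detection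

variable {m r : ℕ}

/-- Pigeonhole: fewer sites than rows cannot meet every row. -/
theorem exists_row_notMem {s : Finset (Fin (m + 1) × Fin (m + 1))} (hs : s.card < m + 1) :
    ∃ i, ∀ j, (i, j) ∉ s := by
  by_contra! h
  have h1 : (Finset.univ : Finset (Fin (m + 1))) ⊆ s.image Prod.fst := fun i _ => by
    obtain ⟨j, hj⟩ := h i
    exact Finset.mem_image.2 ⟨_, hj, rfl⟩
  have h2 := (Finset.card_le_card h1).trans Finset.card_image_le
  rw [Finset.card_univ, Fintype.card_fin] at h2
  omega

theorem exists_col_notMem {s : Finset (Fin (m + 1) × Fin (m + 1))} (hs : s.card < m + 1) :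
    ∃ j, ∀ i, (i, j) ∉ s := by
  by_contra! h
  have h1 : (Finset.univ : Finset (Fin (m + 1))) ⊆ s.image Prod.snd := fun j _ => by
    obtain ⟨i, hi⟩ := h j
    exact Finset.mem_image.2 ⟨_, hi, rfl⟩
  have h2 := (Finset.card_le_card h1).trans Finset.card_image_le
  rw [Finset.card_univ, Fintype.card_fin] at h2
  omega

/-- An error that misses a row either has even rows or is detected by a pair of rows. -/
theorem rowEven_or_exists {x : Lattice m} {i₀ : Fin (m + 1)} (h : ∀ j, x (i₀, j) = 0) :
    RowEven x ∨ ∃ u : Fin (m + 1) → ZMod 2, ∑ i, u i = 0 ∧ rowVec u ⬝ᵥ x = 1 := by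
  by_cases hx : RowEven x
  · exact Or.inl hx
  · obtain ⟨i, hi⟩ := not_forall.1 hx
    -- The missed row adds nothing to the syndrome but makes the number of rows even, so the
    -- operator is a stabilizer.
    refine Or.inr ⟨Pi.single i 1 + Pi.single i₀ 1, ?_, ?_⟩
    · simp [Finset.sum_add_distrib, CharTwo.add_self_eq_zero]
    · rw [rowVec_dotProduct]
      simpa [add_mul, Finset.sum_add_distrib, Pi.single_apply, h] using
        (zmod_two_cases _).resolve_left hi

/-- An error that misses a column either has even columns or is detected by a pair of columns. -/
theorem colEven_or_exists {z : Lattice m} {j₀ : Fin (m + 1)} (h : ∀ i, z (i, j₀) = 0) :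
    ColEven z ∨ ∃ t : Fin (m + 1) → ZMod 2, ∑ j, t j = 0 ∧ z ⬝ᵥ colVec t = 1 := by
  refine (rowEven_or_exists (x := z ∘ Prod.swap) h).imp id ?_
  rintro ⟨t, ht, h1⟩
  refine ⟨t, ht, ?_⟩
  rw [dotProduct_comm, ← h1, ← comp_swap_dotProduct]
  rfl

/-- A row of even parity with one nonzero entry has a second one. -/
theorem two_le_card_of_rowEven {x : Lattice m} (hx : RowEven x) {s : Finset _}
    (hs : ∀ p, x p ≠ 0 → p ∈ s) (h0 : x ≠ 0) : 2 ≤ s.card := by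
  obtain ⟨⟨i, j⟩, hp⟩ := Function.ne_iff.1 h0
  obtain ⟨k, hk, hq⟩ : ∃ k, k ≠ j ∧ x (i, k) ≠ 0 := by
    by_contra! h
    have h1 := hx i
    rw [Finset.sum_eq_single j (fun k _ hk => h k hk) (by simp)] at h1
    exact hp h1
  rw [← Finset.card_pair (a := (i, j)) (b := (i, k)) (by simp [hk.symm])]
  refine Finset.card_le_card fun p hp' => ?_
  rcases Finset.mem_insert.1 hp' with rfl | hp'
  · exact hs _ hp
  · rw [Finset.mem_singleton.1 hp']
    exact hs _ hq

theorem eq_zero_of_weight_lt_two {x z : Lattice m} (hw : weight x z < 2) (hx : RowEven x)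
    (hz : ColEven z) : x = 0 ∧ z = 0 := by
  constructor
  · by_contra h
    have := two_le_card_of_rowEven hx
      (s := Finset.univ.filter fun p => x p ≠ 0 ∨ z p ≠ 0) (fun p hp => by simp [hp]) h
    exact absurd hw (not_lt.2 this)
  · by_contra h
    have h1 : z ∘ Prod.swap ≠ 0 := fun h' => h (by
      ext p
      exact congrFun h' p.swap)
    have := two_le_card_of_rowEven (rowEven_comp_swap.2 hz)
      (s := (Finset.univ.filter fun p => x p ≠ 0 ∨ z p ≠ 0).image Prod.swap)
      (fun p hp => Finset.mem_image.2 ⟨p.swap, by simpa using Or.inr hp, by simp⟩) h1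
    exact absurd hw (not_lt.2 (this.trans Finset.card_image_le))

/-- Turns statements about the projection into matrix elements against codewords. -/
theorem HybridCode.starProjection_eq {ι : Type} [Fintype ι] [DecidableEq ι] {K : ℕ} {μ : Type}
    {C : HybridCode ι K μ} {b : μ} {v w : Qubits ι} (hw : w ∈ C.innerCode b)
    (h : ∀ χ, inner ℂ (C.enc b χ) v = inner ℂ (C.enc b χ) w) :
    (C.innerCode b).starProjection v = w := by
  apply Submodule.eq_starProjection_of_mem_of_inner_eq_zero hw
  rintro _ ⟨χ, rfl⟩
  rw [inner_eq_zero_symm]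
  exact (inner_sub_right _ _ _).trans (sub_eq_zero.2 (h χ))

variable (e : Fin r ≃ Fin m × Fin m)

/-- The stabilizer fixes both codewords and anticommutes with the error, so the matrix element
equals its negative. -/
theorem inner_enc_eq_zero_of_row {x z : Lattice m} {u : Fin (m + 1) → ZMod 2}
    (hu : ∑ i, u i = 0) (hx : rowVec u ⬝ᵥ x = 1) (a b : Fin r → ZMod 2)
    (φ χ : EuclideanSpace ℂ (Fin (2 ^ 1))) :
    inner ℂ ((baconShorHybrid e).enc b χ) (opX x (opZ z ((baconShorHybrid e).enc a φ))) = 0 := by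
  have h1 := inner_opZ_opZ (rowVec u) ((baconShorHybrid e).enc b χ)
    (opX x (opZ z ((baconShorHybrid e).enc a φ)))
  have h2 : opZ (rowVec u) (opZ z ((baconShorHybrid e).enc a φ)) =
      opZ z ((baconShorHybrid e).enc a φ) := by
    rw [← LinearEquiv.mul_apply, opZ_comm, LinearEquiv.mul_apply, opZ_rowVec_enc e hu]
  rw [opZ_opX_apply, opZ_rowVec_enc e hu, h2, hx, sgn_one, inner_smul_right] at h1
  linear_combination (-1 / 2 : ℂ) * h1

theorem inner_enc_eq_zero_of_col {x z : Lattice m} {t : Fin (m + 1) → ZMod 2}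
    (ht : ∑ j, t j = 0) (hz : z ⬝ᵥ colVec t = 1) (a b : Fin r → ZMod 2)
    (φ χ : EuclideanSpace ℂ (Fin (2 ^ 1))) :
    inner ℂ ((baconShorHybrid e).enc b χ) (opX x (opZ z ((baconShorHybrid e).enc a φ))) = 0 := by
  have h1 := inner_opX_opX (colVec t) ((baconShorHybrid e).enc b χ)
    (opX x (opZ z ((baconShorHybrid e).enc a φ)))
  have h2 : opX (colVec t) (opZ z ((baconShorHybrid e).enc a φ)) =
      -opZ z ((baconShorHybrid e).enc a φ) := by
    conv_rhs => rw [← opX_colVec_enc e ht, opZ_opX_apply, hz, sgn_one, neg_smul, one_smul, neg_neg]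
  rw [opX_colVec_enc e ht, ← LinearEquiv.mul_apply (opX (colVec t)), opX_comm,
    LinearEquiv.mul_apply, h2, map_neg, inner_neg_right] at h1
  linear_combination (-1 / 2 : ℂ) * h1

/-- Gauge operators permute the inner codes and do not affect the quantum information. -/
theorem exists_opX_opZ_enc {x z : Lattice m} (hx : RowEven x) (hz : ColEven z)
    (a : Fin r → ZMod 2) : ∃ (s : ℂ) (a' : Fin r → ZMod 2), ∀ φ,
      opX x (opZ z ((baconShorHybrid e).enc a φ)) = s • (baconShorHybrid e).enc a' φ := by
  -- The combined translation is a stabilizer plus the shift of a new message; the `Z` part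
  -- contributes only a sign independent of the state.
  obtain ⟨t, f, ht, h⟩ := (hx.add (rowEven_shift e a)).exists_eq
  refine ⟨sgn (z ⬝ᵥ shift e a), fun i => f (e i), fun φ => ?_⟩
  have h1 : ∑ q, f q • xVec q = shift e fun i => f (e i) :=
    (e.sum_comp fun q => f q • xVec q).symm
  rw [opZ_enc e hz, map_smul, ← opX_colVec_enc e ht (fun i => f (e i)), enc_apply, enc_apply,
    ← opX_add_apply,
    ← opX_add_apply, h, h1]

/-- Errors of weight less than `m + 1` are detected by a stabilizer or are gauge operators. -/
theorem detection_cases {x z : Lattice m} (hw : weight x z < m + 1) :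
    (∀ (a b : Fin r → ZMod 2) φ χ, inner ℂ ((baconShorHybrid e).enc b χ)
      (opX x (opZ z ((baconShorHybrid e).enc a φ))) = 0) ∨ (RowEven x ∧ ColEven z) := by
  -- The weight counts the union of the two supports, so the missed row serves for `x` and the
  -- missed column for `z`.
  obtain ⟨i, hi⟩ := exists_row_notMem hw
  obtain ⟨j, hj⟩ := exists_col_notMem hw
  rcases rowEven_or_exists (x := x) (i₀ := i) (fun j => by
    by_contra h
    exact hi j (by simp [h])) with hx | ⟨u, hu, hx⟩
  · rcases colEven_or_exists (z := z) (j₀ := j) (fun i => by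
      by_contra h
      exact hj i (by simp [h])) with hz | ⟨t, ht, hz⟩
    · exact Or.inr ⟨hx, hz⟩
    · exact Or.inl (inner_enc_eq_zero_of_col e ht hz)
  · exact Or.inl (inner_enc_eq_zero_of_row e hu hx)

theorem detectsQuantum_baconShorHybrid : (baconShorHybrid e).DetectsQuantum (m + 1) := by
  intro x z hw a b φ
  rcases detection_cases e hw with h | ⟨hx, hz⟩
  · refine ⟨0, ?_⟩
    rw [zero_smul]
    exact HybridCode.starProjection_eq (Submodule.zero_mem _) fun χ => by
      rw [h, inner_zero_right]
  · obtain ⟨s, a', h⟩ := exists_opX_opZ_enc e hx hz a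
    rw [h]
    by_cases hab : b = a'
    · subst hab
      exact ⟨s, HybridCode.starProjection_eq (Submodule.smul_mem _ _ ⟨φ, rfl⟩) fun _ => rfl⟩
    · refine ⟨0, ?_⟩
      rw [zero_smul]
      exact HybridCode.starProjection_eq (Submodule.zero_mem _) fun χ => by
        rw [inner_smul_right, (baconShorHybrid e).orthogonal b a' hab, mul_zero, inner_zero_right]

theorem detectsClassical_baconShorHybrid (hm : 1 ≤ m) :
    (baconShorHybrid e).DetectsClassical 2 := by
  intro x z hw a b hab φ
  refine HybridCode.starProjection_eq (Submodule.zero_mem _) fun χ => ?_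
  rw [inner_zero_right]
  -- The assumption `1 ≤ m` puts weights below 2 in the range of the quantum dichotomy.
  rcases detection_cases e (hw.trans_le (by omega)) with h | ⟨hx, hz⟩
  · exact h a b φ χ
  · obtain ⟨rfl, rfl⟩ := eq_zero_of_weight_lt_two hw hx hz
    rw [opX_zero, opZ_zero]
    exact (baconShorHybrid e).orthogonal b a hab.symm χ φ

theorem HybridCode.starProjection_enc {ι : Type} [Fintype ι] [DecidableEq ι] {K : ℕ} {μ : Type}
    {C : HybridCode ι K μ} {b : μ} {v : Qubits ι} (hv : v ∈ C.innerCode b) :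
    (C.innerCode b).starProjection v = v :=
  HybridCode.starProjection_eq hv fun _ => rfl

/-- The operator `X` on a full column is a nontrivial logical operator. -/
theorem not_detectsQuantum_baconShorHybrid :
    ¬ (baconShorHybrid e).DetectsQuantum (m + 1 + 1) := by
  intro h
  let t : Fin (m + 1) → ZMod 2 := Pi.single 0 1
  have hw : weight (colVec t : Lattice m) 0 < m + 1 + 1 := by
    have : (Finset.univ.filter fun p : Fin (m + 1) × Fin (m + 1) =>
        (colVec t : Lattice m) p ≠ 0 ∨ (0 : Lattice m) p ≠ 0) ⊆
        Finset.univ.image fun i : Fin (m + 1) => (i, (0 : Fin (m + 1))) := by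
      rintro ⟨i, j⟩ hp
      have hj : j = 0 := by simpa [colVec, t, Pi.single_apply] using hp
      simp [hj]
    have h1 := (Finset.card_le_card this).trans Finset.card_image_le
    rw [Finset.card_univ, Fintype.card_fin] at h1
    exact Nat.lt_succ_of_le h1
  let φ : EuclideanSpace ℂ (Fin (2 ^ 1)) := EuclideanSpace.single (bit 0) 1
  obtain ⟨s, hs⟩ := h (colVec t) 0 hw 0 0 φ
  rw [opZ_zero, enc_zero_apply] at hs
  -- The column operator commutes with every stabilizer and fixed gauge operator, so the corrupted
  -- state passes the projection unchanged.
  have hmem : opX (colVec t) (baseEnc m φ) ∈ (baconShorHybrid e).innerCode 0 := by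
    refine (mem_innerCode e).2 ⟨mem_fixedSpace_baconShorStab.2 ⟨fun u hu => ?_, fun t' ht => ?_⟩,
      fun i => ?_⟩
    · rw [opZ_opX_apply, (colEven_rowVec hu).dotProduct_colVec, opZ_baseEnc (colEven_rowVec hu),
        sgn_zero, one_smul]
    · rw [← opX_add_apply, add_comm (colVec t'), opX_add_apply, opX_baseEnc ht]
    · rw [opZ_opX_apply, (colEven_zVec _).dotProduct_colVec, opZ_baseEnc (colEven_zVec _)]
      rfl
  -- At this odd word the corrupted state has the nonzero amplitude of bit 0, while every multiple
  -- of the original vanishes.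
  have h1 := congrArg (· (colVec t)) ((HybridCode.starProjection_enc hmem).symm.trans hs)
  simp only [opX_apply, PiLp.smul_apply, add_self_two] at h1
  have h0 : (0 : Lattice m) = colVec 0 := rfl
  rw [h0, baseEnc_colVec, baseEnc_colVec] at h1
  have hb : bit 1 ≠ bit 0 := bit.injective.ne one_ne_zero
  have ht1 : ∑ j, t j = 1 := by simp [t]
  rw [ht1] at h1
  simp [φ, hb, normConst_ne_zero] at h1

/-- The gauge operators `X(xVec q)` are undetected errors to the classical information. -/
theorem not_detectsClassical_baconShorHybrid (hr : 0 < r) :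
    ¬ (baconShorHybrid e).DetectsClassical (2 + 1) := by
  intro h
  let i : Fin r := ⟨0, hr⟩
  have hw : weight (xVec (e i)) 0 < 2 + 1 := by
    have : (Finset.univ.filter fun p : Fin (m + 1) × Fin (m + 1) =>
        xVec (e i) p ≠ 0 ∨ (0 : Lattice m) p ≠ 0) ⊆
        {((e i).1.castSucc, (e i).2.castSucc), ((e i).1.castSucc, Fin.last m)} := by
      intro p hp
      by_contra hne
      simp only [Finset.mem_insert, Finset.mem_singleton, not_or] at hne
      simp [xVec, hne] at hp
    exact Nat.lt_succ_of_le ((Finset.card_le_card this).trans Finset.card_le_two)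
  let φ : EuclideanSpace ℂ (Fin (2 ^ 1)) := EuclideanSpace.single (bit 0) 1
  have hne : (0 : Fin r → ZMod 2) ≠ Pi.single i 1 := fun h => by
    simpa using congrFun h i
  have h1 := h (xVec (e i)) 0 hw 0 (Pi.single i 1) hne φ
  have h2 : shift e (Pi.single i 1) = xVec (e i) := by
    simp [shift, Pi.single_apply]
  -- This error of weight at most 2 carries message 0 exactly to another message.
  have h3 : opX (xVec (e i)) (baseEnc m φ) = (baconShorHybrid e).enc (Pi.single i 1) φ := by
    rw [enc_apply, h2]
  rw [opZ_zero, enc_zero_apply] at h1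
  have h4 : (baconShorHybrid e).enc (Pi.single i 1) φ = 0 := by
    rw [← HybridCode.starProjection_enc (C := baconShorHybrid e) (b := Pi.single i 1)
      (v := (baconShorHybrid e).enc (Pi.single i 1) φ) ⟨φ, rfl⟩, ← h3]
    exact h1
  have h5 : φ = 0 := ((baconShorHybrid e).enc (Pi.single i 1)).injective (by rw [h4, map_zero])
  simpa [φ] using congrArg norm h5

end Detection

/-- Detection of quantum errors is monotone in the distance. -/
theorem HybridCode.DetectsQuantum.mono {ι : Type} [Fintype ι] [DecidableEq ι] {K : ℕ} {μ : Type}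
    {C : HybridCode ι K μ} {d d' : ℕ} (h : C.DetectsQuantum d') (hd : d ≤ d') :
    C.DetectsQuantum d := fun x z hw => h x z (hw.trans_le hd)

end HybridBS

end

/-! ### Assembly of the three claims -/

theorem mainTheorem3 (n : ℕ) (hn : 2 ≤ n) :
    -- a hybrid stabilizer code with the stated parameters arises from the Bacon–Shor code by
    -- gauge fixing; its two minimum distances are exactly `n` and `2`, and it meets the bound
    (∃ C : HybridBS.HybridCode (Fin n × Fin n) (2 ^ 1) (Fin ((n - 1) ^ 2) → ZMod 2),
      HybridBS.IsGaugeFixing (HybridBS.baconShorStab n) (HybridBS.baconShorGauge n) C ∧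
      C.IsStabilizer ∧
      C.HasParameters (n ^ 2) 1 ((n - 1) ^ 2) n 2 ∧
      ¬ C.DetectsQuantum (n + 1) ∧
      ¬ C.DetectsClassical (2 + 1) ∧
      ∀ N k m d c : ℕ, C.HasParameters N k m d c → ¬ C.DetectsQuantum (d + 1) →
        (k : ℤ) + (m : ℤ) = (N : ℤ) - 2 * ((d : ℤ) - 1)) ∧
    -- no pair of ingredients for the trivial construction yields these parameters
    (∀ (n₁ n₂ : ℕ) (Q : Submodule ℂ (HybridBS.Qubits (Fin n₁)))
      (D : Finset (Fin n₂ → ZMod 2)),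
      HybridBS.IsQuantumCode Q (2 ^ 1) n →
      HybridBS.IsClassicalCode D (2 ^ ((n - 1) ^ 2)) 2 →
      n₁ + n₂ ≠ n ^ 2) ∧
    -- no code produced by the trivial construction, from any ingredients, has these parameters
    (∀ (n₁ n₂ K : ℕ) (μ : Type)
      (V : EuclideanSpace ℂ (Fin K) →ₗᵢ[ℂ] HybridBS.Qubits (Fin n₁))
      (w : μ ↪ (Fin n₂ → ZMod 2)),
      ¬ (HybridBS.trivialHybrid V w).HasParameters (n ^ 2) 1 ((n - 1) ^ 2) n 2) := by
  obtain ⟨m, rfl⟩ : ∃ m, n = m + 1 := ⟨n - 1, by omega⟩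
  have hm : 1 ≤ m := by omega
  have hr : 0 < (m + 1 - 1) ^ 2 := by simpa using Nat.pow_pos hm
  have hno : ∀ (n₁ n₂ : ℕ) (Q : Submodule ℂ (HybridBS.Qubits (Fin n₁)))
      (D : Finset (Fin n₂ → ZMod 2)), HybridBS.IsQuantumCode Q (2 ^ 1) (m + 1) →
      HybridBS.IsClassicalCode D (2 ^ ((m + 1 - 1) ^ 2)) 2 → n₁ + n₂ ≠ (m + 1) ^ 2 := by
    intro n₁ n₂ Q D hQ hD h
    have h1 := hQ.two_mul_lt_card le_rfl (Nat.succ_pos m)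
    have h2 := hD.lt_length hr
    rw [Fintype.card_fin] at h1
    simp only [Nat.add_sub_cancel] at h1 h2
    -- The bounds give `n₁ ≥ 2m + 1` and `n₂ ≥ m² + 1`, one more in total than `(m + 1)²`.
    nlinarith
  refine ⟨?_, hno, ?_⟩
  · let e : Fin ((m + 1 - 1) ^ 2) ≃ Fin m × Fin m :=
      (finCongr (by rw [Nat.add_sub_cancel, sq])).trans finProdFinEquiv.symm
    have hnd := HybridBS.not_detectsQuantum_baconShorHybrid e
    refine ⟨HybridBS.baconShorHybrid e, HybridBS.isGaugeFixing_baconShorHybrid e,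
      HybridBS.isStabilizer_baconShorHybrid e,
      ⟨by simp [sq], rfl, by simp, HybridBS.detectsQuantum_baconShorHybrid e,
        HybridBS.detectsClassical_baconShorHybrid e hm⟩, hnd,
      HybridBS.not_detectsClassical_baconShorHybrid e hr, ?_⟩
    intro N k s d c h hd
    have hN : N = (m + 1) * (m + 1) := by
      rw [← h.length]; simp
    have hk : k = 1 := Nat.pow_right_injective le_rfl h.quantum.symm
    have hs : s = m ^ 2 := Nat.pow_right_injective le_rfl (by
      simpa using h.classical.symm)
    -- Any admissible `d` with `d + 1` not detected is the exact quantum distance, pinned from both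
    -- sides by monotonicity.
    have hd1 : d ≤ m + 1 := by
      by_contra! hlt
      exact hnd (h.detectsQuantum.mono hlt)
    have hd2 : m + 1 ≤ d := by
      by_contra! hlt
      exact hd ((HybridBS.detectsQuantum_baconShorHybrid e).mono hlt)
    obtain rfl : d = m + 1 := le_antisymm hd1 hd2
    subst hN hk hs
    push_cast
    ring
  · intro n₁ n₂ K μ V w h
    obtain rfl := h.quantum
    have hcard := h.classical
    -- `Nat.card` is 0 on infinite and on empty types, so its positive value gives both finiteness
    -- and a message.
    have : Finite μ := Nat.finite_of_card_ne_zero (by rw [hcard]; positivity)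
    have : Nonempty μ := (Nat.card_pos_iff.1 (by rw [hcard]; positivity)).1
    have := Fintype.ofFinite μ
    rw [Nat.card_eq_fintype_card] at hcard
    have hD := HybridBS.isClassicalCode_of_trivialHybrid (by norm_num) h.detectsClassical
    rw [hcard] at hD
    exact hno n₁ n₂ _ _ (HybridBS.isQuantumCode_of_trivialHybrid h.detectsQuantum) hD
      (by simpa using h.length)
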